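/- Let $d\ge 1$ and let $\kappa$ be a probability density function on $\mathbb{R}^d$ that is bounded and Lebesgue-almost everywhere continuous. Let $\mathcal M$ be the space of compact subsets of $\mathbb{R}^d$ with the Borel $\sigma$-algebra of the Hausdorff distance, let $T$ be a random element of $\mathcal M$ with distribution $\mu_{\mathcal M}$, and write $\|t\|$ for the Lebesgue measure of $t\in\mathcal M$. For $\lambda>0$ let $\mathcal P_\lambda$ be a Poisson point process in $\mathbb{R}^d\times\mathcal M$ with intensity measure $\lambda\,(\kappa(x)\,dx\times\mu_{\mathcal M})$, and for $n\in\mathbb N$ let $\mathcal X_n$ be the point process consisting of $n$ independent random elements of $\mathbb{R}^d\times\mathcal M$ with common distribution $\kappa(x)\,dx\times\mu_{\mathcal M}$. For finite $\mathcal X\subset\mathbb{R}^d\times\mathcal M$ and $\lambda>0$ put $$\Xi_\lambda(\mathcal X)=\bigcup_{(x,t)\in\mathcal X}\bigl(x+\lambda^{-1/d}t\bigr).$$ Suppose that for $q=1$ or $q=2$, and for some $p>q$, we have $\mathbb E[\|T\|^p]<\infty$, and let $f:\mathbb{R}^d\to\mathbb{R}$ be bounded and Borel measurable. Then there is a (finite,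 non-random) constant $c\in\mathbb{R}$ such that, as $\lambda\to\infty$, $$\int_{\Xi_\lambda(\mathcal P_\lambda)} f(x)\,dx\longrightarrow c\quad\text{in }L^q,$$ and such that, whenever $(\lambda(n))_{n\ge1}$ is a sequence of real numbers with $\lambda(n)/n\to1$ as $n\to\infty$, $$\int_{\Xi_{\lambda(n)}(\mathcal X_n)} f(x)\,dx\longrightarrow c\quad\text{in }L^q .$$ -/

import Mathlib

open MeasureTheory ProbabilityTheory Filter Topology TopologicalSpace
open scoped ENNReal NNReal

/-- The space of compact subsets of a topological space carries the Borel σ-algebra of Mathlib's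
topology on `Compacts` (Vietoris topology; for metric spaces, the topology of the Hausdorff
distance, with the empty set isolated). -/
instance compactsMeasurableSpace (α : Type*) [TopologicalSpace α] :
    MeasurableSpace (Compacts α) :=
  borel (Compacts α)

instance compactsBorelSpace (α : Type*) [TopologicalSpace α] : BorelSpace (Compacts α) :=
  ⟨rfl⟩

namespace GermGrain

/-- `κ` is a probability density function on `ℝ^d` which is bounded and Lebesgue-almost everywhere
continuous. -/
structure IsAdmissibleDensity {d : ℕ} (κ : EuclideanSpace ℝ (Fin d) → ℝ) : Prop where
  measurable : Measurable κ
  nonneg : ∀ x, 0 ≤ κ x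
  lintegral_eq_one : ∫⁻ x, ENNReal.ofReal (κ x) = 1
  bounded : ∃ C : ℝ, ∀ x, κ x ≤ C
  ae_continuous : ∀ᵐ x, ContinuousAt κ x

/-- The probability distribution on `ℝ^d` with density `κ` with respect to Lebesgue measure. -/
noncomputable def densityMeasure {d : ℕ} (κ : EuclideanSpace ℝ (Fin d) → ℝ) :
    Measure (EuclideanSpace ℝ (Fin d)) :=
  volume.withDensity fun x => ENNReal.ofReal (κ x)

/-- The random set `N` of points of `S`, defined on the probability space `(Ω, Pr)`, is a Poisson
point process with intensity measure `Λ`: the numbers of points in measurable sets are random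
variables, they are Poisson distributed with mean `Λ B` whenever `Λ B` is finite, and they are
independent for pairwise disjoint sets. -/
structure IsPoissonProcess {Ω S : Type*} [MeasurableSpace Ω] [MeasurableSpace S]
    (N : Ω → Set S) (Λ : Measure S) (Pr : Measure Ω) : Prop where
  measurable_count : ∀ B : Set S, MeasurableSet B → Measurable fun ω => (N ω ∩ B).encard
  law_count : ∀ B : Set S, MeasurableSet B → Λ B ≠ ∞ →
    Pr.map (fun ω => (N ω ∩ B).encard)
      = (poissonMeasure (Λ B).toNNReal).map (Nat.cast : ℕ → ℕ∞)
  indep_count : ∀ (k : ℕ) (B : Fin k → Set S), (∀ i, MeasurableSet (B i)) →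
    Pairwise (fun i j => Disjoint (B i) (B j)) →
    iIndepFun (fun i ω => (N ω ∩ B i).encard) Pr

/-- The random set `N` of points of `S`, defined on the probability space `(Ω, Pr)`, is a binomial
point process: it consists of `n` independent random elements of `S` with common
distribution `Q`. -/
def IsBinomialProcess {Ω S : Type*} [MeasurableSpace Ω] [MeasurableSpace S]
    (N : Ω → Set S) (n : ℕ) (Q : Measure S) (Pr : Measure Ω) : Prop :=
  ∃ Y : Fin n → Ω → S, (∀ i, Measurable (Y i)) ∧ (∀ i, Pr.map (Y i) = Q) ∧
    iIndepFun Y Pr ∧ ∀ ω, N ω = Set.range fun i => Y i ω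

/-- The germ-grain set `Ξ_l(X) = ⋃_{(x, t) ∈ X} (x + l ^ (-1/d) t)` in `ℝ^d`. -/
noncomputable def grainUnion {d : ℕ} (l : ℝ)
    (X : Set (EuclideanSpace ℝ (Fin d) × Compacts (EuclideanSpace ℝ (Fin d)))) :
    Set (EuclideanSpace ℝ (Fin d)) :=
  ⋃ z ∈ X, (fun u => z.1 + (l ^ (-(1 : ℝ) / (d : ℝ))) • u) ''
    (z.2 : Set (EuclideanSpace ℝ (Fin d)))

/-- The real random variables `F i` converge in `L^q` to the constant `c` along the filter `l`:
eventually `F i` belongs to `L^q`, and the `L^q` norm of `F i - c` tends to zero. -/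
def ConvergesInLq {Ω ι : Type*} [MeasurableSpace Ω] (F : ι → Ω → ℝ) (l : Filter ι) (c : ℝ)
    (q : ℝ≥0∞) (Pr : Measure Ω) : Prop :=
  (∀ᶠ i in l, MemLp (F i) q Pr) ∧
    Tendsto (fun i => eLpNorm (fun ω => F i ω - c) q Pr) l (𝓝 0)

end GermGrain

/-! Write `Z = ∫ x in Ξ, f x`. By Fubini the mean and variance of `Z` depend only on the
probabilities that `Ξ` covers one or two given points. The point `x` is covered exactly when the
process hits the set `grainCover l x` of germ-grain pairs covering `x`. So only hitting
probabilities matter, and `HasPoissonLikeHits` records three bounds on them that hold both for the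
Poisson process (`M = l`) and for the binomial process (`M = n`). Everything else is common to the
two, which is why they share the limit `grainLimit`.

Mean. With `Q` the law of one germ-grain pair, the coverage probability of `x` is close to `1 -
exp(-M Q(grainCover l x))`. Substituting `y = x - s u`, where `s ^ d = l⁻¹`, turns `l Q(grainCover l
x)` into an integral of `κ` at points approaching `x`. It tends to `κ x * E‖T‖` wherever `κ` is
continuous. The space has infinite volume, so pointwise convergence does not suffice; but the total
integral over `x` is `E‖T‖` for every `l`, so Scheffé's lemma gives convergence in `L¹`.

Variance. The covariance of two hitting events is at most `M (Q(B ∩ B') + Q B * Q B')`. Integrated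
over pairs of points this gives `M l⁻² (E‖T‖² + (E‖T‖)²)`, which vanishes in the limit because `M /
l → 1`. This settles `q = 2`.

For `q = 1` the second moment may be infinite. Grains of volume above `K` are discarded, which costs
at most `sup |f| * (M / l) * E[‖T‖; ‖T‖ > K]` in `L¹`. The variance bound applies to the rest, and
`K` is chosen large before `l → ∞`. -/

namespace GermGrain

set_option linter.unusedSectionVars false

/-! ### Means, variances and comparison of integrals over a random set -/

section RandomSet

variable {Ω E : Type*} [MeasurableSpace Ω] [MeasurableSpace E]

/-- The integral of `f` over the random set whose realisations are the sections of `G`. -/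
noncomputable def sectionIntegral (ν : Measure E) (G : Set (Ω × E)) (f : E → ℝ) (ω : Ω) : ℝ :=
  ∫ x in {x | (ω, x) ∈ G}, f x ∂ν

/-- The probability that the random set with sections of `G` as realisations contains `x`. -/
noncomputable def coverProb (Pr : Measure Ω) (G : Set (Ω × E)) (x : E) : ℝ :=
  Pr.real {ω | (ω, x) ∈ G}

variable {Pr : Measure Ω} [IsProbabilityMeasure Pr] {ν : Measure E} [SigmaFinite ν]
  {G G' : Set (Ω × E)} {f : E → ℝ} {C : ℝ}

lemma measurableSet_section (hG : MeasurableSet G) (ω : Ω) : MeasurableSet {x | (ω, x) ∈ G} :=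
  measurable_prodMk_left hG

lemma sectionIntegral_eq (hG : MeasurableSet G) (ω : Ω) :
    sectionIntegral ν G f ω = ∫ x, G.indicator (fun p => f p.2) (ω, x) ∂ν := by
  rw [sectionIntegral, ← integral_indicator (measurableSet_section hG ω)]
  rfl

lemma stronglyMeasurable_sectionIntegral (hG : MeasurableSet G) (hf : Measurable f) :
    StronglyMeasurable (sectionIntegral ν G f) := by
  have : sectionIntegral ν G f = fun ω => ∫ x, G.indicator (fun p => f p.2) (ω, x) ∂ν :=
    funext fun ω => sectionIntegral_eq hG ω
  rw [this]
  exact StronglyMeasurable.integral_prod_right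
    (f := fun ω x => G.indicator (fun p : Ω × E => f p.2) (ω, x))
    ((hf.comp measurable_snd).indicator hG).stronglyMeasurable

lemma coverProb_nonneg (x : E) : 0 ≤ coverProb Pr G x := measureReal_nonneg

lemma ofReal_coverProb (x : E) :
    ENNReal.ofReal (coverProb Pr G x) = Pr {ω | (ω, x) ∈ G} := by
  rw [coverProb, ofReal_measureReal]

lemma integrable_indicator_of_lintegral_ne_top (hG : MeasurableSet G) (hf : Measurable f)
    (hC : ∀ x, |f x| ≤ C) (hfin : ∫⁻ x, Pr {ω | (ω, x) ∈ G} ∂ν ≠ ∞) :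
    Integrable (G.indicator (fun p => f p.2)) (Pr.prod ν) := by
  rw [integrable_indicator_iff hG]
  refine Measure.integrableOn_of_bounded (M := C) ?_
    (hf.comp measurable_snd).aestronglyMeasurable (ae_of_all _ fun p => hC p.2)
  rwa [Measure.prod_apply_symm hG]

lemma ae_measure_section_lt_top (hG : MeasurableSet G)
    (hfin : ∫⁻ x, Pr {ω | (ω, x) ∈ G} ∂ν ≠ ∞) :
    ∀ᵐ ω ∂Pr, ν {x | (ω, x) ∈ G} < ∞ := by
  have h : (Pr.prod ν) G ≠ ∞ := by rwa [Measure.prod_apply_symm hG]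
  rw [Measure.prod_apply hG] at h
  exact ae_lt_top (measurable_measure_prodMk_left hG) h

lemma integrable_sectionIntegral (hG : MeasurableSet G) (hf : Measurable f)
    (hC : ∀ x, |f x| ≤ C) (hfin : ∫⁻ x, Pr {ω | (ω, x) ∈ G} ∂ν ≠ ∞) :
    Integrable (sectionIntegral ν G f) Pr := by
  have := (integrable_indicator_of_lintegral_ne_top hG hf hC hfin).integral_prod_left
  exact this.congr (ae_of_all _ fun ω => (sectionIntegral_eq hG ω).symm)

lemma integral_sectionIntegral (hG : MeasurableSet G) (hf : Measurable f)
    (hC : ∀ x, |f x| ≤ C) (hfin : ∫⁻ x, Pr {ω | (ω, x) ∈ G} ∂ν ≠ ∞) :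
    ∫ ω, sectionIntegral ν G f ω ∂Pr = ∫ x, f x * coverProb Pr G x ∂ν := by
  simp_rw [sectionIntegral_eq hG]
  rw [integral_integral_swap (f := fun ω x => G.indicator (fun p : Ω × E => f p.2) (ω, x))
    (integrable_indicator_of_lintegral_ne_top hG hf hC hfin)]
  refine integral_congr_ae (ae_of_all _ fun x => ?_)
  have hm : MeasurableSet {ω | (ω, x) ∈ G} := measurable_prodMk_right hG
  have : (fun ω => G.indicator (fun p : Ω × E => f p.2) (ω, x))
      = {ω | (ω, x) ∈ G}.indicator fun _ => f x := rfl
  simp only [this]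
  rw [integral_indicator_const _ hm, smul_eq_mul, mul_comm, coverProb]

lemma integrable_mul_coverProb (hG : MeasurableSet G) (hf : Measurable f)
    (hC : ∀ x, |f x| ≤ C) (hfin : ∫⁻ x, Pr {ω | (ω, x) ∈ G} ∂ν ≠ ∞) :
    Integrable (fun x => f x * coverProb Pr G x) ν := by
  have hh : Integrable (coverProb Pr G) ν := integrable_toReal_of_lintegral_ne_top
    (measurable_measure_prodMk_right hG).aemeasurable hfin
  exact hh.bdd_mul hf.aestronglyMeasurable (c := C) (ae_of_all _ fun x => hC x)

/-- Fubini turns the expected volume of the removed part into an integral of probabilities. This is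
what measures the cost of discarding large grains. -/
lemma lintegral_enorm_sectionIntegral_sub_le (hG : MeasurableSet G) (hG' : MeasurableSet G')
    (hf : Measurable f) (hC : ∀ x, |f x| ≤ C)
    (hfin : ∫⁻ x, Pr {ω | (ω, x) ∈ G} ∂ν ≠ ∞)
    (hsub : ∀ᵐ ω ∂Pr, {x | (ω, x) ∈ G'} ⊆ {x | (ω, x) ∈ G}) :
    ∫⁻ ω, ‖sectionIntegral ν G f ω - sectionIntegral ν G' f ω‖ₑ ∂Pr
      ≤ ENNReal.ofReal C * ∫⁻ x, Pr {ω | (ω, x) ∈ G \ G'} ∂ν := by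
  calc ∫⁻ ω, ‖sectionIntegral ν G f ω - sectionIntegral ν G' f ω‖ₑ ∂Pr
      ≤ ∫⁻ ω, ENNReal.ofReal C * ν {x | (ω, x) ∈ G \ G'} ∂Pr := by
        refine lintegral_mono_ae ?_
        filter_upwards [ae_measure_section_lt_top hG hfin, hsub] with ω hω hs
        have hint : IntegrableOn f {x | (ω, x) ∈ G} ν := Measure.integrableOn_of_bounded (M := C)
          hω.ne hf.aestronglyMeasurable (ae_of_all _ fun x => hC x)
        have hd := setIntegral_sdiff (measurableSet_section hG' ω) hint hs
        rw [sectionIntegral, sectionIntegral, ← hd]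
        refine (enorm_integral_le_lintegral_enorm _).trans ?_
        calc ∫⁻ x in {x | (ω, x) ∈ G} \ {x | (ω, x) ∈ G'}, ‖f x‖ₑ ∂ν
            ≤ ∫⁻ _ in {x | (ω, x) ∈ G} \ {x | (ω, x) ∈ G'}, ENNReal.ofReal C ∂ν := by
              refine lintegral_mono fun x => ?_
              rw [← ofReal_norm]
              exact ENNReal.ofReal_le_ofReal (hC x)
          _ = ENNReal.ofReal C * ν {x | (ω, x) ∈ G \ G'} := by
              rw [setLIntegral_const]; rfl
    _ = ENNReal.ofReal C * ∫⁻ x, Pr {ω | (ω, x) ∈ G \ G'} ∂ν := by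
        rw [lintegral_const_mul' _ _ ENNReal.ofReal_ne_top]
        congr 1
        exact (Measure.prod_apply (hG.diff hG')).symm.trans
          (Measure.prod_apply_symm (hG.diff hG'))

/-- Second moments of integrals over a random set are governed by the covariances of the
events that the random set contains given points. -/
theorem eLpNorm_two_sectionIntegral_sub_le (hG : MeasurableSet G) (hf : Measurable f)
    (hC : ∀ x, |f x| ≤ C) (hC0 : 0 ≤ C) (hfin : ∫⁻ x, Pr {ω | (ω, x) ∈ G} ∂ν ≠ ∞)
    (R : E × E → ℝ≥0∞)
    (hRfin : ∫⁻ p, R p ∂(ν.prod ν) ≠ ∞)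
    (hR : ∀ x y, ENNReal.ofReal |Pr.real {ω | (ω, x) ∈ G ∧ (ω, y) ∈ G}
      - coverProb Pr G x * coverProb Pr G y| ≤ R (x, y)) :
    eLpNorm (fun ω => sectionIntegral ν G f ω - ∫ ω', sectionIntegral ν G f ω' ∂Pr) 2 Pr
      ≤ ENNReal.ofReal C * (∫⁻ p, R p ∂(ν.prod ν)) ^ (1 / 2 : ℝ) := by
  -- The square of the integral is the integral of `f ⊗ f` over the random set of pairs of covered
  -- points, so the first-moment formula applied to `G2` yields the second moment.
  set G2 : Set (Ω × (E × E)) := {p | (p.1, p.2.1) ∈ G ∧ (p.1, p.2.2) ∈ G} with hG2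
  have hG2m : MeasurableSet G2 := by
    have h1 : Measurable fun p : Ω × (E × E) => (p.1, p.2.1) := by fun_prop
    have h2 : Measurable fun p : Ω × (E × E) => (p.1, p.2.2) := by fun_prop
    exact (h1 hG).inter (h2 hG)
  have hPm : Measurable fun x => Pr {ω | (ω, x) ∈ G} := measurable_measure_prodMk_right hG
  have hprod : ∫⁻ p : E × E, Pr {ω | (ω, p.1) ∈ G} * Pr {ω | (ω, p.2) ∈ G} ∂(ν.prod ν)
      = (∫⁻ x, Pr {ω | (ω, x) ∈ G} ∂ν) * ∫⁻ x, Pr {ω | (ω, x) ∈ G} ∂ν :=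
    lintegral_prod_mul hPm.aemeasurable hPm.aemeasurable
  have hfin2 : ∫⁻ p, Pr {ω | (ω, p) ∈ G2} ∂(ν.prod ν) ≠ ∞ := by
    -- Square integrability is not assumed: it follows from the covariance bound, since a joint
    -- probability is at most the product of the marginals plus `R`.
    have hle : ∫⁻ p, Pr {ω | (ω, p) ∈ G2} ∂(ν.prod ν)
        ≤ ∫⁻ p, (Pr {ω | (ω, p.1) ∈ G} * Pr {ω | (ω, p.2) ∈ G} + R p) ∂(ν.prod ν) := by
      refine lintegral_mono fun p => ?_
      have h1 := hR p.1 p.2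
      have h2 : Pr {ω | (ω, p) ∈ G2} = ENNReal.ofReal (Pr.real {ω | (ω, p) ∈ G2}) := by
        rw [ofReal_measureReal]
      have h3 : Pr {ω | (ω, p.1) ∈ G} * Pr {ω | (ω, p.2) ∈ G}
          = ENNReal.ofReal (coverProb Pr G p.1 * coverProb Pr G p.2) := by
        rw [ENNReal.ofReal_mul (coverProb_nonneg _), ofReal_coverProb, ofReal_coverProb]
      rw [h2, h3]
      refine le_trans ?_ (add_le_add le_rfl h1)
      rw [← ENNReal.ofReal_add (mul_nonneg (coverProb_nonneg _) (coverProb_nonneg _))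
        (abs_nonneg _)]
      refine ENNReal.ofReal_le_ofReal ?_
      have := le_abs_self (Pr.real {ω | (ω, p.1) ∈ G ∧ (ω, p.2) ∈ G}
        - coverProb Pr G p.1 * coverProb Pr G p.2)
      have he : {ω | (ω, p) ∈ G2} = {ω | (ω, p.1) ∈ G ∧ (ω, p.2) ∈ G} := rfl
      rw [he]; linarith
    refine ne_top_of_le_ne_top ?_ hle
    have hm : Measurable fun p : E × E => Pr {ω | (ω, p.1) ∈ G} * Pr {ω | (ω, p.2) ∈ G} :=
      (hPm.comp measurable_fst).mul (hPm.comp measurable_snd)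
    rw [lintegral_add_left hm, hprod]
    exact ENNReal.add_ne_top.2 ⟨ENNReal.mul_ne_top hfin hfin, hRfin⟩
  set f2 : E × E → ℝ := fun p => f p.1 * f p.2 with hf2
  have hf2m : Measurable f2 := by fun_prop
  have hf2C : ∀ p, |f2 p| ≤ C * C := fun p => by
    rw [hf2, abs_mul]
    exact mul_le_mul (hC _) (hC _) (abs_nonneg _) hC0
  have hsq : ∀ ω, sectionIntegral (ν.prod ν) G2 f2 ω = sectionIntegral ν G f ω ^ 2 := fun ω => by
    have : {p : E × E | (ω, p) ∈ G2} = {x | (ω, x) ∈ G} ×ˢ {x | (ω, x) ∈ G} := rfl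
    rw [sectionIntegral, sectionIntegral, this, hf2, setIntegral_prod_mul, sq]
  have hmem : MemLp (sectionIntegral ν G f) 2 Pr := by
    rw [memLp_two_iff_integrable_sq
      (stronglyMeasurable_sectionIntegral hG hf).aestronglyMeasurable]
    exact (integrable_sectionIntegral hG2m hf2m hf2C hfin2).congr (ae_of_all _ hsq)
  have hvar : Var[sectionIntegral ν G f; Pr]
      = ∫ p, f2 p * (coverProb Pr G2 p - coverProb Pr G p.1 * coverProb Pr G p.2)
        ∂(ν.prod ν) := by
    rw [variance_eq_sub hmem]
    have h1 : ∫ ω, (sectionIntegral ν G f ^ 2) ω ∂Pr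
        = ∫ p, f2 p * coverProb Pr G2 p ∂(ν.prod ν) := by
      rw [← integral_sectionIntegral hG2m hf2m hf2C hfin2]
      exact integral_congr_ae (ae_of_all _ fun ω => (hsq ω).symm)
    have hi := integrable_mul_coverProb hG hf hC hfin
    have h2 : (∫ ω, sectionIntegral ν G f ω ∂Pr) ^ 2
        = ∫ p, f2 p * (coverProb Pr G p.1 * coverProb Pr G p.2) ∂(ν.prod ν) := by
      rw [integral_sectionIntegral hG hf hC hfin, sq, ← integral_prod_mul]
      refine integral_congr_ae (ae_of_all _ fun p => ?_)
      simp only [hf2]; ring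
    rw [h1, h2, ← integral_sub (integrable_mul_coverProb hG2m hf2m hf2C hfin2)]
    · refine integral_congr_ae (ae_of_all _ fun p => ?_)
      simp only; ring
    · refine (hi.mul_prod hi).congr (ae_of_all _ fun p => ?_)
      simp only [hf2]; ring
  have hev : evariance (sectionIntegral ν G f) Pr
      ≤ ENNReal.ofReal C ^ 2 * ∫⁻ p, R p ∂(ν.prod ν) := by
    rw [← ofReal_variance hmem, hvar]
    refine (ENNReal.ofReal_le_ofReal (le_abs_self _)).trans ?_
    rw [← Real.norm_eq_abs, ofReal_norm]
    refine (enorm_integral_le_lintegral_enorm _).trans ?_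
    rw [← lintegral_const_mul' _ _ (by simp)]
    refine lintegral_mono fun p => ?_
    rw [enorm_mul, ← ofReal_norm, ← ofReal_norm]
    refine mul_le_mul' ?_ (hR p.1 p.2)
    rw [← ENNReal.ofReal_pow hC0, sq]
    exact ENNReal.ofReal_le_ofReal (hf2C p)
  rw [eLpNorm_eq_lintegral_rpow_enorm_toReal (by simp) (by simp)]
  have h2 : ∫⁻ ω, ‖sectionIntegral ν G f ω - ∫ ω', sectionIntegral ν G f ω' ∂Pr‖ₑ
      ^ (2 : ℝ≥0∞).toReal ∂Pr = evariance (sectionIntegral ν G f) Pr := by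
    rw [evariance]; simp
  rw [h2]
  refine (ENNReal.rpow_le_rpow hev (by simp)).trans (le_of_eq ?_)
  rw [ENNReal.mul_rpow_of_nonneg _ _ (by simp), ← ENNReal.rpow_natCast, ← ENNReal.rpow_mul]
  simp

end RandomSet

/-! ### Hitting probabilities of Poisson and binomial processes -/

section Hits

variable {Ω S : Type*} [MeasurableSpace Ω] [MeasurableSpace S]

/-- The event that the random set `N` hits `B`. -/
def hitEvent (N : Ω → Set S) (B : Set S) : Set Ω := {ω | (N ω ∩ B).Nonempty}

/-- A random set which is almost surely finite and whose hitting probabilities and their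
covariances are close to those of a Poisson process with intensity `M • Q`. -/
structure HasPoissonLikeHits (N : Ω → Set S) (M : ℝ) (Q : Measure S) (Pr : Measure Ω) :
    Prop where
  intensity_nonneg : 0 ≤ M
  ae_finite : ∀ᵐ ω ∂Pr, (N ω).Finite
  measurableSet_hit : ∀ B, MeasurableSet B → MeasurableSet (hitEvent N B)
  hit_le : ∀ B, MeasurableSet B → Pr.real (hitEvent N B) ≤ M * Q.real B
  abs_hit_sub_le : ∀ B, MeasurableSet B →
    |Pr.real (hitEvent N B) - (1 - Real.exp (-(M * Q.real B)))| ≤ M * Q.real B ^ 2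
  abs_cov_le : ∀ B B', MeasurableSet B → MeasurableSet B' →
    |Pr.real (hitEvent N B ∩ hitEvent N B') - Pr.real (hitEvent N B) * Pr.real (hitEvent N B')|
      ≤ M * (Q.real (B ∩ B') + Q.real B * Q.real B')

lemma hitEvent_union (N : Ω → Set S) (B B' : Set S) :
    hitEvent N (B ∪ B') = hitEvent N B ∪ hitEvent N B' := by
  ext ω
  simp only [hitEvent, Set.mem_ofPred_eq, Set.mem_union, Set.inter_union_distrib_left,
    Set.union_nonempty]

/-- Two events have the same covariance as their complements, and avoiding both `B` and `B'` is
avoiding `B ∪ B'`. When the avoidance probability is a function `v` of `Q B` alone, all the bounds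
therefore reduce to inequalities for `v`; in `hv_mul` the numbers `a`, `b`, `c` stand for `Q B`, `Q
B'`, `Q (B ∩ B')`. -/
lemma HasPoissonLikeHits.of_avoidance {N : Ω → Set S} {M : ℝ} {Q : Measure S} {Pr : Measure Ω}
    [IsProbabilityMeasure Pr] [IsProbabilityMeasure Q] (hM : 0 ≤ M) (v : ℝ → ℝ)
    (hfin : ∀ᵐ ω ∂Pr, (N ω).Finite)
    (hmeas : ∀ B, MeasurableSet B → MeasurableSet (hitEvent N B))
    (hv : ∀ B, MeasurableSet B → Pr.real (hitEvent N B) = 1 - v (Q.real B))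
    (hv_le : ∀ b, 0 ≤ b → b ≤ 1 → 1 - v b ≤ M * b)
    (hv_exp : ∀ b, 0 ≤ b → b ≤ 1 → |v b - Real.exp (-(M * b))| ≤ M * b ^ 2)
    (hv_mul : ∀ a b c, 0 ≤ c → c ≤ a → c ≤ b → a ≤ 1 → b ≤ 1 → a + b - c ≤ 1 →
      |v (a + b - c) - v a * v b| ≤ M * (c + a * b)) :
    HasPoissonLikeHits N M Q Pr where
  intensity_nonneg := hM
  ae_finite := hfin
  measurableSet_hit := hmeas
  hit_le B hB := by
    rw [hv B hB]
    exact hv_le _ measureReal_nonneg measureReal_le_one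
  abs_hit_sub_le B hB := by
    rw [hv B hB, abs_sub_comm]
    convert hv_exp (Q.real B) measureReal_nonneg measureReal_le_one using 2
    ring
  abs_cov_le B B' hB hB' := by
    have hu := measureReal_union_add_inter (μ := Pr) (s := hitEvent N B) (hmeas B' hB')
    have hQ := measureReal_union_add_inter (μ := Q) (s := B) hB'
    rw [← hitEvent_union, hv _ (hB.union hB'), hv _ hB, hv _ hB'] at hu
    have hQ' : Q.real (B ∪ B') = Q.real B + Q.real B' - Q.real (B ∩ B') := by linarith
    have h1 : Q.real (B ∪ B') ≤ 1 := measureReal_le_one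
    have := hv_mul (Q.real B) (Q.real B') (Q.real (B ∩ B')) measureReal_nonneg
      (measureReal_mono Set.inter_subset_left) (measureReal_mono Set.inter_subset_right)
      measureReal_le_one measureReal_le_one (hQ' ▸ h1)
    rw [← hQ'] at this
    rw [hv _ hB, hv _ hB']
    convert this using 2
    linarith

theorem IsPoissonProcess.hasPoissonLikeHits {N : Ω → Set S} {l : ℝ} (hl : 0 < l)
    {Q : Measure S} {Pr : Measure Ω} [IsProbabilityMeasure Pr] [IsProbabilityMeasure Q]
    (h : IsPoissonProcess N (ENNReal.ofReal l • Q) Pr) : HasPoissonLikeHits N l Q Pr := by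
  have hcompl : ∀ B, (hitEvent N B)ᶜ = (fun ω => (N ω ∩ B).encard) ⁻¹' {0} := fun B => by
    ext ω
    simp [hitEvent, Set.not_nonempty_iff_eq_empty]
  have hmeas : ∀ B, MeasurableSet B → MeasurableSet (hitEvent N B) := fun B hB => by
    rw [← compl_compl (hitEvent N B), hcompl]
    exact (h.measurable_count B hB (measurableSet_singleton _)).compl
  have hne : ∀ B, (ENNReal.ofReal l • Q) B ≠ ∞ := fun B => by
    simpa using ENNReal.mul_ne_top ENNReal.ofReal_ne_top (measure_ne_top Q B)
  have hcast : Measurable (Nat.cast : ℕ → ℕ∞) := measurable_from_top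
  refine .of_avoidance hl.le (fun b => Real.exp (-(l * b))) ?_ hmeas ?_ ?_ ?_ ?_
  -- The total intensity is `l`, which is finite, so the total number of points has a Poisson law
  -- and is almost surely not `⊤`.
  · have hm := h.measurable_count Set.univ MeasurableSet.univ
    have h0 : Pr ((fun ω => (N ω ∩ Set.univ).encard) ⁻¹' {⊤}) = 0 := by
      rw [← Measure.map_apply hm (measurableSet_singleton _),
        h.law_count _ MeasurableSet.univ (hne _), Measure.map_apply hcast
        (measurableSet_singleton _)]
      have : (Nat.cast : ℕ → ℕ∞) ⁻¹' {⊤} = ∅ := by ext; simp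
      rw [this, measure_empty]
    filter_upwards [measure_eq_zero_iff_ae_notMem.1 h0] with ω hω
    simpa [Set.encard_eq_top_iff] using hω
  · intro B hB
    have : Pr.real ((hitEvent N B)ᶜ) = Real.exp (-(l * Q.real B)) := by
      rw [hcompl, measureReal_def, ← Measure.map_apply (h.measurable_count B hB)
        (measurableSet_singleton _), h.law_count B hB (hne B), Measure.map_apply hcast
        (measurableSet_singleton _)]
      have h0 : (Nat.cast : ℕ → ℕ∞) ⁻¹' {0} = {0} := by ext; simp
      rw [h0, ← measureReal_def, poissonMeasure_real_singleton]
      simp only [measureReal_def, Measure.smul_apply, smul_eq_mul, ENNReal.coe_toNNReal_eq_toReal,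
        ENNReal.toReal_mul, ENNReal.toReal_ofReal hl.le]
      simp
    rw [← this, probReal_compl_eq_one_sub (hmeas B hB)]
    ring
  · intro b _ _
    linarith [Real.add_one_le_exp (-(l * b))]
  · intro b _ _
    simpa using mul_nonneg hl.le (sq_nonneg b)
  · intro a b c hc hca hcb _ _ _
    have e : Real.exp (-(l * (a + b - c))) - Real.exp (-(l * a)) * Real.exp (-(l * b))
        = Real.exp (-(l * (a + b - c))) * (1 - Real.exp (-(l * c))) := by
      rw [mul_sub (Real.exp _), mul_one, ← Real.exp_add, ← Real.exp_add]
      ring_nf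
    have h1 : Real.exp (-(l * c)) ≤ 1 := Real.exp_le_one_iff.2 (by nlinarith)
    have h2 : Real.exp (-(l * (a + b - c))) ≤ 1 := Real.exp_le_one_iff.2 (by nlinarith)
    have h3 := Real.add_one_le_exp (-(l * c))
    have hab : 0 ≤ l * (a * b) := mul_nonneg hl.le (mul_nonneg (hc.trans hca) (hc.trans hcb))
    rw [e, abs_of_nonneg (mul_nonneg (Real.exp_pos _).le (by linarith))]
    calc Real.exp (-(l * (a + b - c))) * (1 - Real.exp (-(l * c)))
        ≤ 1 * (1 - Real.exp (-(l * c))) := mul_le_mul_of_nonneg_right h2 (by linarith)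
      _ ≤ l * (c + a * b) := by rw [mul_add]; linarith

lemma abs_pow_sub_pow_le_of_abs_le_one {a b : ℝ} (ha : |a| ≤ 1) (hb : |b| ≤ 1) (n : ℕ) :
    |a ^ n - b ^ n| ≤ n * |a - b| := by
  refine (abs_pow_sub_pow_le a b n).trans ?_
  rw [mul_comm |a - b|]
  exact mul_le_of_le_one_right (by positivity) (pow_le_one₀ (by positivity) (max_le ha hb))

/-- Independence gives `v b = (1 - b) ^ n`. An `n`-th power is `n`-Lipschitz on `[-1, 1]`, so each
comparison reduces to one of the bases, with `n` in the role of the intensity. -/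
theorem IsBinomialProcess.hasPoissonLikeHits {N : Ω → Set S} {n : ℕ}
    {Q : Measure S} {Pr : Measure Ω} [IsProbabilityMeasure Pr] [IsProbabilityMeasure Q]
    (h : IsBinomialProcess N n Q Pr) : HasPoissonLikeHits N n Q Pr := by
  obtain ⟨Y, hY, hlaw, hind, hN⟩ := h
  have hcompl : ∀ B, (hitEvent N B)ᶜ = ⋂ i ∈ Finset.univ, Y i ⁻¹' Bᶜ := fun B => by
    ext ω
    simp only [hitEvent, hN, Set.mem_compl_iff, Set.mem_ofPred_eq, Set.not_nonempty_iff_eq_empty,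
      Finset.mem_univ, Set.iInter_true, Set.mem_iInter, Set.mem_preimage,
      Set.eq_empty_iff_forall_notMem, Set.mem_inter_iff, Set.mem_range, not_and]
    exact ⟨fun h i => h _ ⟨i, rfl⟩, by rintro h _ ⟨i, rfl⟩; exact h i⟩
  have hmeas : ∀ B, MeasurableSet B → MeasurableSet (hitEvent N B) := fun B hB => by
    rw [← compl_compl (hitEvent N B), hcompl]
    exact (Finset.measurableSet_biInter _ fun i _ => hY i hB.compl).compl
  refine .of_avoidance n.cast_nonneg (fun b => (1 - b) ^ n) ?_ hmeas ?_ ?_ ?_ ?_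
  · refine ae_of_all _ fun ω => ?_
    rw [hN]
    exact Set.finite_range _
  · intro B hB
    have : Pr.real ((hitEvent N B)ᶜ) = (1 - Q.real B) ^ n := by
      rw [hcompl, measureReal_def, hind.measure_inter_preimage_eq_mul Finset.univ
        (fun _ _ => hB.compl), ENNReal.toReal_prod]
      have : ∀ i, (Pr (Y i ⁻¹' Bᶜ)).toReal = 1 - Q.real B := fun i => by
        rw [← Measure.map_apply (hY i) hB.compl, hlaw, ← measureReal_def,
          probReal_compl_eq_one_sub hB]
      simp_rw [this]
      simp
    rw [← this, probReal_compl_eq_one_sub (hmeas B hB)]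
    ring
  · intro b _ hb
    have := one_add_mul_le_pow (a := -b) (by linarith) n
    rw [← sub_eq_add_neg] at this
    linarith
  · intro b hb hb1
    have e : Real.exp (-(n * b)) = Real.exp (-b) ^ n := by
      rw [← Real.exp_nat_mul]; ring_nf
    rw [e]
    have h1 : |1 - b| ≤ 1 := abs_le.2 ⟨by linarith, by linarith⟩
    have h2 : |Real.exp (-b)| ≤ 1 := by
      rw [abs_of_pos (Real.exp_pos _)]
      exact Real.exp_le_one_iff.2 (by linarith)
    refine (abs_pow_sub_pow_le_of_abs_le_one h1 h2 n).trans ?_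
    refine mul_le_mul_of_nonneg_left ?_ n.cast_nonneg
    have := Real.abs_exp_sub_one_sub_id_le (x := -b) (by rwa [abs_neg, abs_of_nonneg hb])
    rw [neg_sq] at this
    rwa [abs_sub_comm, show Real.exp (-b) - (1 - b) = Real.exp (-b) - 1 - -b by ring]
  · intro a b c hc hca hcb ha hb hab
    have ha0 : 0 ≤ a := hc.trans hca
    have hb0 : 0 ≤ b := hc.trans hcb
    have h1 : |1 - (a + b - c)| ≤ 1 := abs_le.2 ⟨by linarith, by linarith⟩
    have h2 : |(1 - a) * (1 - b)| ≤ 1 := by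
      rw [abs_of_nonneg (mul_nonneg (by linarith) (by linarith))]
      exact mul_le_one₀ (by linarith) (by linarith) (by linarith)
    rw [← mul_pow]
    refine (abs_pow_sub_pow_le_of_abs_le_one h1 h2 n).trans ?_
    -- The bases `1 - (a + b - c)` and `(1 - a) * (1 - b)` differ by `c - a * b`.
    refine mul_le_mul_of_nonneg_left ?_ n.cast_nonneg
    have h3 : 0 ≤ a * b := mul_nonneg ha0 hb0
    refine abs_le.2 ⟨by linarith, by linarith⟩

end Hits

/-! ### Scaling and measurability of the grains -/

section Grains

variable {d : ℕ}

/-- The contraction factor `l ^ (-1/d)` applied to the grains. -/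
noncomputable def grainScale (d : ℕ) (l : ℝ) : ℝ := l ^ (-(1 : ℝ) / (d : ℝ))

/-- The set of germ-grain pairs whose rescaled grain covers `x`. -/
def grainCover (l : ℝ) (x : EuclideanSpace ℝ (Fin d)) :
    Set (EuclideanSpace ℝ (Fin d) × Compacts (EuclideanSpace ℝ (Fin d))) :=
  {z | x ∈ (fun u => z.1 + grainScale d l • u) '' (z.2 : Set (EuclideanSpace ℝ (Fin d)))}

lemma grainScale_pos {l : ℝ} (hl : 0 < l) : 0 < grainScale d l := Real.rpow_pos_of_pos hl _

lemma grainScale_pow (hd : 1 ≤ d) {l : ℝ} (hl : 0 < l) : grainScale d l ^ d = l⁻¹ := by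
  have : (d : ℝ) ≠ 0 := by positivity
  rw [grainScale, ← Real.rpow_natCast, ← Real.rpow_mul hl.le, div_mul_cancel₀ _ this,
    Real.rpow_neg_one]

lemma tendsto_grainScale (hd : 1 ≤ d) : Tendsto (grainScale d) atTop (𝓝 0) := by
  have : (0 : ℝ) < 1 / d := by positivity
  have h := tendsto_rpow_neg_atTop this
  unfold grainScale
  simpa [neg_div] using h

lemma mem_grainUnion_iff {l : ℝ}
    {X : Set (EuclideanSpace ℝ (Fin d) × Compacts (EuclideanSpace ℝ (Fin d)))}
    {x : EuclideanSpace ℝ (Fin d)} :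
    x ∈ grainUnion l X ↔ (X ∩ grainCover l x).Nonempty := by
  simp only [grainUnion, Set.mem_iUnion, exists_prop]
  rfl

lemma mem_grainCover_iff {l : ℝ} (hl : 0 < l) {x : EuclideanSpace ℝ (Fin d)}
    {z : EuclideanSpace ℝ (Fin d) × Compacts (EuclideanSpace ℝ (Fin d))} :
    z ∈ grainCover l x ↔ (grainScale d l)⁻¹ • (x - z.1) ∈ z.2 := by
  have hs := (grainScale_pos (d := d) hl).ne'
  constructor
  · rintro ⟨u, hu, rfl⟩
    simpa [smul_smul, hs] using hu
  · intro h
    exact ⟨_, h, by simp [smul_smul, hs]⟩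

/-- The complement says that the compact sets `{p.2}` and `p.1` are disjoint, an open condition in
the Vietoris topology. -/
lemma isClosed_mem_compacts (α : Type*) [TopologicalSpace α] [T2Space α] :
    IsClosed {p : Compacts α × α | p.2 ∈ p.1} := by
  rw [← isOpen_compl_iff]
  have h : Continuous fun p : Compacts α × α => (({p.2} : Compacts α), p.1) :=
    (Compacts.continuous_singleton.comp continuous_snd).prodMk continuous_fst
  convert Compacts.isOpen_setOfPred_disjoint_coe.preimage h using 1
  ext p
  simp

lemma measurableSet_mem_compacts (d : ℕ) :
    MeasurableSet {p : Compacts (EuclideanSpace ℝ (Fin d)) × EuclideanSpace ℝ (Fin d) |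
      p.2 ∈ p.1} :=
  (isClosed_mem_compacts _).measurableSet

lemma measurable_volume_compacts (d : ℕ) :
    Measurable fun t : Compacts (EuclideanSpace ℝ (Fin d)) =>
      volume (t : Set (EuclideanSpace ℝ (Fin d))) :=
  measurable_measure_prodMk_left (measurableSet_mem_compacts d)

lemma measurableSet_grainCover_graph {l : ℝ} (hl : 0 < l) :
    MeasurableSet {p : EuclideanSpace ℝ (Fin d) ×
      (EuclideanSpace ℝ (Fin d) × Compacts (EuclideanSpace ℝ (Fin d))) |
      p.2 ∈ grainCover l p.1} := by
  simp_rw [mem_grainCover_iff hl]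
  have h : Measurable fun p : EuclideanSpace ℝ (Fin d) ×
      (EuclideanSpace ℝ (Fin d) × Compacts (EuclideanSpace ℝ (Fin d))) =>
      (p.2.2, (grainScale d l)⁻¹ • (p.1 - p.2.1)) := by fun_prop
  exact h (measurableSet_mem_compacts d)

lemma measurableSet_grainCover {l : ℝ} (hl : 0 < l) (x : EuclideanSpace ℝ (Fin d)) :
    MeasurableSet (grainCover l x) :=
  measurable_prodMk_left (measurableSet_grainCover_graph hl)

open scoped Pointwise in
lemma volume_setOf_mem_grainCover (hd : 1 ≤ d) {l : ℝ} (hl : 0 < l)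
    (z : EuclideanSpace ℝ (Fin d) × Compacts (EuclideanSpace ℝ (Fin d))) :
    volume {x | z ∈ grainCover l x}
      = ENNReal.ofReal l⁻¹ * volume (z.2 : Set (EuclideanSpace ℝ (Fin d))) := by
  have : {x | z ∈ grainCover l x}
      = (fun u => z.1 + u) '' (grainScale d l • (z.2 : Set (EuclideanSpace ℝ (Fin d)))) := by
    ext x
    simp only [grainCover, Set.mem_ofPred_eq, ← Set.image_smul, Set.image_image]
  rw [this, Set.image_add_left, measure_preimage_add, Measure.addHaar_smul,
    finrank_euclideanSpace_fin, grainScale_pow hd hl, abs_of_pos (inv_pos.2 hl)]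

/-- The compact set `{z.1} × z.2` depends continuously on `z`, and hitting a fixed open set is an
open condition. These are the test sets from which the random set is recovered by countable
operations. -/
lemma isOpen_setOf_grain_inter_nonempty (s : ℝ) {U : Set (EuclideanSpace ℝ (Fin d))}
    (hU : IsOpen U) :
    IsOpen {z : EuclideanSpace ℝ (Fin d) × Compacts (EuclideanSpace ℝ (Fin d)) |
      ∃ u ∈ z.2, z.1 + s • u ∈ U} := by
  have h : Continuous fun z : EuclideanSpace ℝ (Fin d) × Compacts (EuclideanSpace ℝ (Fin d)) =>
      ({z.1} : Compacts (EuclideanSpace ℝ (Fin d))) ×ˢ z.2 :=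
    Compacts.continuous_prod.comp
      ((Compacts.continuous_singleton.comp continuous_fst).prodMk continuous_snd)
  have hW : IsOpen {p : EuclideanSpace ℝ (Fin d) × EuclideanSpace ℝ (Fin d) |
      p.1 + s • p.2 ∈ U} := hU.preimage (by fun_prop)
  convert (Compacts.isOpen_inter_nonempty_of_isOpen hW).preimage h using 1
  ext z
  constructor
  · rintro ⟨u, hu, hz⟩
    exact ⟨(z.1, u), by simpa using hu, hz⟩
  · rintro ⟨⟨a, u⟩, hm, hz⟩
    have hm' : a = z.1 ∧ u ∈ z.2 := by simpa using hm
    obtain ⟨rfl, hu⟩ := hm'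
    exact ⟨u, hu, hz⟩

/-- The union of the grains of a random set with measurable hitting events is, where this random
set is finite, a jointly measurable random set. -/
theorem exists_measurableSet_section_grainUnion {Ω : Type*} [MeasurableSpace Ω] (l : ℝ)
    {N : Ω → Set (EuclideanSpace ℝ (Fin d) × Compacts (EuclideanSpace ℝ (Fin d)))}
    (hN : ∀ B, MeasurableSet B → MeasurableSet (hitEvent N B))
    {A : Set (EuclideanSpace ℝ (Fin d) × Compacts (EuclideanSpace ℝ (Fin d)))}
    (hA : MeasurableSet A) :
    ∃ G : Set (Ω × EuclideanSpace ℝ (Fin d)), MeasurableSet G ∧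
      ∀ ω, (N ω).Finite → ∀ x, (ω, x) ∈ G ↔ x ∈ grainUnion l (N ω ∩ A) := by
  set D := denseSeq (EuclideanSpace ℝ (Fin d))
  set T : ℕ → ℕ → Set (EuclideanSpace ℝ (Fin d) × Compacts (EuclideanSpace ℝ (Fin d))) :=
    fun m k => {z | ∃ u ∈ z.2, z.1 + grainScale d l • u ∈ Metric.ball (D k) (1 / (m + 1))}
    with hT
  have hTm : ∀ m k, MeasurableSet (A ∩ T m k) := fun m k =>
    hA.inter (isOpen_setOf_grain_inter_nonempty _ Metric.isOpen_ball).measurableSet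
  -- A closed set contains `x` if and only if, for every `m`, some ball of radius `1 / (m + 1)`
  -- about a point of the dense sequence contains `x` and meets the set. This uses only countably
  -- many hitting events.
  refine ⟨⋂ m, ⋃ k, hitEvent N (A ∩ T m k) ×ˢ Metric.ball (D k) (1 / (m + 1)),
    .iInter fun m => .iUnion fun k => (hN _ (hTm m k)).prod Metric.isOpen_ball.measurableSet,
    fun ω hω x => ?_⟩
  -- Finiteness of `N ω` enters here: the union of finitely many compact grains is closed.
  have hclosed : IsClosed (grainUnion l (N ω ∩ A)) := by
    refine (hω.inter_of_left A).isClosed_biUnion fun z _ => ?_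
    exact (z.2.isCompact.image (by fun_prop)).isClosed
  simp only [Set.mem_iInter, Set.mem_iUnion, Set.mem_prod]
  constructor
  · intro h
    rw [← hclosed.closure_eq, Metric.mem_closure_iff]
    intro ε hε
    obtain ⟨m, hm⟩ := exists_nat_one_div_lt (half_pos hε)
    obtain ⟨k, ⟨z, hzN, hzA, u, hu, hball⟩, hx⟩ := h m
    refine ⟨z.1 + grainScale d l • u, ?_, ?_⟩
    · exact Set.mem_biUnion (show z ∈ N ω ∩ A from ⟨hzN, hzA⟩) ⟨u, hu, rfl⟩
    · rw [Metric.mem_ball] at hball hx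
      have := dist_triangle_right x (z.1 + grainScale d l • u) (D k)
      linarith
  · intro h m
    obtain ⟨z, ⟨hzN, hzA⟩, u, hu, hux⟩ := Set.mem_iUnion₂.1 h
    obtain ⟨k, hk⟩ := (denseRange_denseSeq (EuclideanSpace ℝ (Fin d))).exists_dist_lt x
      (show (0 : ℝ) < 1 / (m + 1) by positivity)
    refine ⟨k, ⟨z, hzN, hzA, u, hu, ?_⟩, hk⟩
    exact (show z.1 + grainScale d l • u = x from hux) ▸ hk

end Grains

/-! ### Scheffé's lemma and an affine change of variables -/

/-- Scheffé's lemma for a filter: if the integrals of `F i` equal the finite integral of `g` and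
`F i` tends to `g` almost everywhere, then `F i` tends to `g` in `L¹`. -/
lemma tendsto_lintegral_ofReal_abs_sub_of_integral_eq {α ι : Type*} [MeasurableSpace α]
    {μ : Measure α} {L : Filter ι} [L.IsCountablyGenerated] {F : ι → α → ℝ≥0∞} {g : α → ℝ≥0∞}
    (hF : ∀ᶠ i in L, Measurable (F i)) (hg : Measurable g) (hgfin : ∫⁻ x, g x ∂μ ≠ ∞)
    (hFg : ∀ᶠ i in L, ∫⁻ x, F i x ∂μ = ∫⁻ x, g x ∂μ)
    (hlim : ∀ᵐ x ∂μ, Tendsto (fun i => F i x) L (𝓝 (g x))) :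
    Tendsto (fun i => ∫⁻ x, ENNReal.ofReal |(F i x).toReal - (g x).toReal| ∂μ) L (𝓝 0) := by
  have h1 : Tendsto (fun i => ∫⁻ x, (g x - F i x) ∂μ) L (𝓝 0) := by
    have := tendsto_lintegral_filter_of_dominated_convergence (l := L) (μ := μ)
      (F := fun i x => g x - F i x) (f := fun _ => 0) g (hF.mono fun i hi => hg.sub hi)
      (Eventually.of_forall fun i => ae_of_all _ fun x => tsub_le_self) hgfin ?_
    · simpa using this
    · filter_upwards [hlim, ae_lt_top hg hgfin] with x hx hgx
      have := ENNReal.Tendsto.sub (tendsto_const_nhds (x := g x) (f := L)) hx (Or.inl hgx.ne)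
      simpa using this
  -- Only the truncated difference `g - F i` is dominated, by `g`. The opposite one has the same
  -- integral, because adding either to the corresponding function gives `max (F i) g` and the
  -- functions have equal finite integrals.
  have h2 : ∀ᶠ i in L, ∫⁻ x, (F i x - g x) ∂μ = ∫⁻ x, (g x - F i x) ∂μ := by
    filter_upwards [hF, hFg] with i hi hig
    have e : ∫⁻ x, (F i x + (g x - F i x)) ∂μ = ∫⁻ x, (g x + (F i x - g x)) ∂μ :=
      lintegral_congr fun x => by rw [add_tsub_eq_max, add_tsub_eq_max, max_comm]
    rw [lintegral_add_left hi, lintegral_add_left hg, hig] at e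
    exact ((ENNReal.add_right_inj hgfin).1 e).symm
  have h3 : Tendsto (fun i => ∫⁻ x, (g x - F i x) ∂μ + ∫⁻ x, (g x - F i x) ∂μ) L (𝓝 0) := by
    simpa using h1.add h1
  refine tendsto_of_tendsto_of_tendsto_of_le_of_le' tendsto_const_nhds h3
    (Eventually.of_forall fun _ => zero_le) ?_
  filter_upwards [hF, hFg, h2] with i hi hig h2i
  nth_rw 1 [← h2i]
  have hsub : Measurable fun x => F i x - g x := hi.sub hg
  rw [← lintegral_add_left hsub]
  refine lintegral_mono_ae ?_
  filter_upwards [ae_lt_top hg hgfin, ae_lt_top hi (hig ▸ hgfin)] with x hgx hFx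
  rcases le_total (F i x) (g x) with h | h
  · rw [abs_of_nonpos (sub_nonpos.2 (ENNReal.toReal_mono hgx.ne h)), neg_sub,
      ← ENNReal.toReal_sub_of_le h hgx.ne, ENNReal.ofReal_toReal (by finiteness)]
    exact le_add_self
  · rw [abs_of_nonneg (sub_nonneg.2 (ENNReal.toReal_mono hFx.ne h)),
      ← ENNReal.toReal_sub_of_le h hFx.ne, ENNReal.ofReal_toReal (by finiteness)]
    exact le_self_add

lemma lintegral_eq_lintegral_sub_smul {d : ℕ} {s : ℝ} (hs : 0 < s)
    (x : EuclideanSpace ℝ (Fin d)) {g : EuclideanSpace ℝ (Fin d) → ℝ≥0∞} (hg : Measurable g) :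
    ∫⁻ y, g y = ENNReal.ofReal (s ^ d) * ∫⁻ u, g (x - s • u) := by
  have h1 : ∫⁻ u, g (x - s • u) = ENNReal.ofReal ((s ^ d)⁻¹) * ∫⁻ y, g (x - y) := by
    have := Measure.map_addHaar_smul (volume : Measure (EuclideanSpace ℝ (Fin d))) hs.ne'
    rw [finrank_euclideanSpace_fin, abs_of_pos (by positivity)] at this
    rw [← smul_eq_mul, ← lintegral_smul_measure, ← this,
      lintegral_map (by fun_prop) (by fun_prop)]
  rw [h1, ← mul_assoc, ← ENNReal.ofReal_mul (by positivity), mul_inv_cancel₀ (by positivity),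
    ENNReal.ofReal_one, one_mul, lintegral_sub_left_eq_self]

/-! ### The measure of the set of grains covering a point -/

section Intensity

variable {d : ℕ} {κ : EuclideanSpace ℝ (Fin d) → ℝ}
  {μT : Measure (Compacts (EuclideanSpace ℝ (Fin d)))} [IsProbabilityMeasure μT]

lemma IsAdmissibleDensity.isProbabilityMeasure (hκ : IsAdmissibleDensity κ) :
    IsProbabilityMeasure (densityMeasure κ) :=
  ⟨by rw [densityMeasure, withDensity_apply _ MeasurableSet.univ, Measure.restrict_univ,
    hκ.lintegral_eq_one]⟩

/-- The mean volume of the grains belonging to `A`. -/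
noncomputable def meanGrain (μT : Measure (Compacts (EuclideanSpace ℝ (Fin d))))
    (A : Set (Compacts (EuclideanSpace ℝ (Fin d)))) (k : ℕ) : ℝ≥0∞ :=
  ∫⁻ t in A, volume (t : Set (EuclideanSpace ℝ (Fin d))) ^ k ∂μT

lemma lintegral_grain_pow (hκ : IsAdmissibleDensity κ)
    (A : Set (Compacts (EuclideanSpace ℝ (Fin d)))) (k : ℕ) :
    ∫⁻ z in Set.univ ×ˢ A, volume (z.2 : Set (EuclideanSpace ℝ (Fin d))) ^ k
      ∂(densityMeasure κ).prod μT = meanGrain μT A k := by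
  have := hκ.isProbabilityMeasure
  have hm : Measurable fun z : EuclideanSpace ℝ (Fin d) × Compacts (EuclideanSpace ℝ (Fin d)) =>
      volume (z.2 : Set (EuclideanSpace ℝ (Fin d))) ^ k :=
    ((measurable_volume_compacts d).comp measurable_snd).pow_const k
  rw [← Measure.prod_restrict, Measure.restrict_univ, meanGrain,
    lintegral_prod_symm _ hm.aemeasurable]
  simp

lemma lintegral_measure_grainCover (hκ : IsAdmissibleDensity κ) (hd : 1 ≤ d) {l : ℝ} (hl : 0 < l)
    (A : Set (Compacts (EuclideanSpace ℝ (Fin d)))) :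
    ∫⁻ x, (densityMeasure κ).prod μT (grainCover l x ∩ Set.univ ×ˢ A)
      = ENNReal.ofReal l⁻¹ * meanGrain μT A 1 := by
  have := hκ.isProbabilityMeasure
  have hW := measurableSet_grainCover_graph (d := d) hl
  set Q := ((densityMeasure κ).prod μT).restrict (Set.univ ×ˢ A)
  calc ∫⁻ x, (densityMeasure κ).prod μT (grainCover l x ∩ Set.univ ×ˢ A)
      = ∫⁻ x, Q (grainCover l x) :=
        lintegral_congr fun x => (Measure.restrict_apply (measurableSet_grainCover hl x)).symm
    _ = ∫⁻ z, volume {x | z ∈ grainCover l x} ∂Q :=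
        (Measure.prod_apply hW).symm.trans (Measure.prod_apply_symm hW)
    _ = ENNReal.ofReal l⁻¹ * meanGrain μT A 1 := by
        simp_rw [volume_setOf_mem_grainCover hd hl]
        rw [lintegral_const_mul' _ _ ENNReal.ofReal_ne_top, ← lintegral_grain_pow hκ A]
        simp [Q]

/-- For a fixed grain, the pairs of points it covers form the square of the rescaled grain, of
volume `(l⁻¹ ‖t‖)²`. This is where the second moment of the grain volume enters. -/
lemma lintegral_measure_grainCover_inter (hκ : IsAdmissibleDensity κ) (hd : 1 ≤ d) {l : ℝ}
    (hl : 0 < l) (A : Set (Compacts (EuclideanSpace ℝ (Fin d)))) :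
    ∫⁻ p : EuclideanSpace ℝ (Fin d) × EuclideanSpace ℝ (Fin d), (densityMeasure κ).prod μT
        (grainCover l p.1 ∩ grainCover l p.2 ∩ Set.univ ×ˢ A)
      = ENNReal.ofReal l⁻¹ ^ 2 * meanGrain μT A 2 := by
  have := hκ.isProbabilityMeasure
  have hW := measurableSet_grainCover_graph (d := d) hl
  set Q := ((densityMeasure κ).prod μT).restrict (Set.univ ×ˢ A)
  have hW2 : MeasurableSet {p : (EuclideanSpace ℝ (Fin d) × EuclideanSpace ℝ (Fin d)) ×
      (EuclideanSpace ℝ (Fin d) × Compacts (EuclideanSpace ℝ (Fin d))) |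
      p.2 ∈ grainCover l p.1.1 ∩ grainCover l p.1.2} := by
    have h1 : Measurable fun p : (EuclideanSpace ℝ (Fin d) × EuclideanSpace ℝ (Fin d)) ×
      (EuclideanSpace ℝ (Fin d) × Compacts (EuclideanSpace ℝ (Fin d))) => (p.1.1, p.2) := by
      fun_prop
    have h2 : Measurable fun p : (EuclideanSpace ℝ (Fin d) × EuclideanSpace ℝ (Fin d)) ×
      (EuclideanSpace ℝ (Fin d) × Compacts (EuclideanSpace ℝ (Fin d))) => (p.1.2, p.2) := by
      fun_prop
    exact (h1 hW).inter (h2 hW)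
  calc ∫⁻ p : EuclideanSpace ℝ (Fin d) × EuclideanSpace ℝ (Fin d), (densityMeasure κ).prod μT
        (grainCover l p.1 ∩ grainCover l p.2 ∩ Set.univ ×ˢ A)
      = ∫⁻ p : EuclideanSpace ℝ (Fin d) × EuclideanSpace ℝ (Fin d),
          Q (grainCover l p.1 ∩ grainCover l p.2) :=
        lintegral_congr fun p => (Measure.restrict_apply
          ((measurableSet_grainCover hl p.1).inter (measurableSet_grainCover hl p.2))).symm
    _ = ∫⁻ z, volume {p : EuclideanSpace ℝ (Fin d) × EuclideanSpace ℝ (Fin d) |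
          z ∈ grainCover l p.1 ∩ grainCover l p.2} ∂Q :=
        (Measure.prod_apply hW2).symm.trans (Measure.prod_apply_symm hW2)
    _ = ∫⁻ z, ENNReal.ofReal l⁻¹ ^ 2 * volume (z.2 : Set (EuclideanSpace ℝ (Fin d))) ^ 2 ∂Q := by
        refine lintegral_congr fun z => ?_
        have : {p : EuclideanSpace ℝ (Fin d) × EuclideanSpace ℝ (Fin d) |
          z ∈ grainCover l p.1 ∩ grainCover l p.2}
          = {x | z ∈ grainCover l x} ×ˢ {x | z ∈ grainCover l x} := rfl
        rw [this, Measure.volume_eq_prod, Measure.prod_prod, volume_setOf_mem_grainCover hd hl]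
        ring
    _ = ENNReal.ofReal l⁻¹ ^ 2 * meanGrain μT A 2 := by
        rw [lintegral_const_mul' _ _ (by finiteness), ← lintegral_grain_pow hκ A]

/-- The measure on grains and points of the grains which gives mass `E‖T‖` in total. -/
noncomputable def grainPointMeasure (μT : Measure (Compacts (EuclideanSpace ℝ (Fin d)))) :
    Measure (Compacts (EuclideanSpace ℝ (Fin d)) × EuclideanSpace ℝ (Fin d)) :=
  (μT.prod volume).restrict {p | p.2 ∈ p.1}

lemma grainPointMeasure_univ :
    grainPointMeasure μT Set.univ = meanGrain μT Set.univ 1 := by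
  rw [grainPointMeasure, Measure.restrict_apply_univ,
    Measure.prod_apply (measurableSet_mem_compacts d), meanGrain, Measure.restrict_univ]
  simp only [pow_one]
  rfl

/-- After the substitution `y = x - s u`, a germ at `y` with grain `t` covers `x` exactly when `u ∈
t`. The domain of integration thus no longer depends on `l`, which allows dominated convergence. -/
lemma measure_grainCover (hκ : IsAdmissibleDensity κ) (hd : 1 ≤ d) {l : ℝ} (hl : 0 < l)
    (x : EuclideanSpace ℝ (Fin d)) :
    (densityMeasure κ).prod μT (grainCover l x) = ENNReal.ofReal l⁻¹ *
      ∫⁻ p, ENNReal.ofReal (κ (x - grainScale d l • p.2)) ∂grainPointMeasure μT := by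
  have := hκ.isProbabilityMeasure
  have hs := grainScale_pos (d := d) hl
  have hκm := hκ.measurable
  rw [Measure.prod_apply_symm (measurableSet_grainCover hl x), grainPointMeasure,
    ← lintegral_indicator (measurableSet_mem_compacts d), lintegral_prod _
      (Measurable.aemeasurable (Measurable.indicator (by fun_prop) (measurableSet_mem_compacts d))),
    ← lintegral_const_mul' _ _ ENNReal.ofReal_ne_top]
  refine lintegral_congr fun t => ?_
  have hm : MeasurableSet ((fun y => (y, t)) ⁻¹' grainCover l x) :=
    measurable_prodMk_right (measurableSet_grainCover hl x)
  rw [densityMeasure, withDensity_apply _ hm, ← lintegral_indicator hm,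
    lintegral_eq_lintegral_sub_smul hs x (Measurable.indicator (by fun_prop) hm),
    grainScale_pow hd hl]
  congr 1
  refine lintegral_congr fun u => ?_
  have hiff : x - grainScale d l • u ∈ (fun y => (y, t)) ⁻¹' grainCover l x ↔ u ∈ t := by
    change (x - grainScale d l • u, t) ∈ grainCover l x ↔ u ∈ t
    rw [mem_grainCover_iff hl]
    simp [smul_smul, hs.ne']
  simp only [Set.indicator]
  split_ifs with h1 h2 h2
  · rfl
  · exact absurd (hiff.1 h1) h2
  · exact absurd (hiff.2 h2) h1
  · rfl

lemma measure_grainCover_le (hκ : IsAdmissibleDensity κ) (hd : 1 ≤ d) {l : ℝ} (hl : 0 < l)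
    {Cκ : ℝ} (hC : ∀ x, κ x ≤ Cκ) (x : EuclideanSpace ℝ (Fin d)) :
    (densityMeasure κ).prod μT (grainCover l x)
      ≤ ENNReal.ofReal l⁻¹ * (ENNReal.ofReal Cκ * meanGrain μT Set.univ 1) := by
  rw [measure_grainCover hκ hd hl, ← grainPointMeasure_univ, ← lintegral_const]
  gcongr
  exact hC _

/-- The rescaled intensity of the grains covering `x` converges in `L¹`. -/
theorem tendsto_lintegral_measure_grainCover_sub (hκ : IsAdmissibleDensity κ) (hd : 1 ≤ d)
    (hm : meanGrain μT Set.univ 1 ≠ ∞) :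
    Tendsto (fun l : ℝ => ∫⁻ x, ENNReal.ofReal
      |l * ((densityMeasure κ).prod μT).real (grainCover l x)
        - κ x * (meanGrain μT Set.univ 1).toReal|) atTop (𝓝 0) := by
  have := hκ.isProbabilityMeasure
  have hκm := hκ.measurable
  set Q := (densityMeasure κ).prod μT
  set m := meanGrain μT Set.univ 1
  have hmeas : ∀ l : ℝ, 0 < l → Measurable fun x => Q (grainCover l x) := fun l hl =>
    measurable_measure_prodMk_left (measurableSet_grainCover_graph hl)
  have hfinite : IsFiniteMeasure (grainPointMeasure μT) :=
    ⟨by rw [grainPointMeasure_univ]; exact hm.lt_top⟩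
  have hg : ∫⁻ x, ENNReal.ofReal (κ x) * m = m := by
    rw [lintegral_mul_const _ (by fun_prop), hκ.lintegral_eq_one, one_mul]
  have key := tendsto_lintegral_ofReal_abs_sub_of_integral_eq
    (μ := (volume : Measure (EuclideanSpace ℝ (Fin d)))) (L := (atTop : Filter ℝ))
    (F := fun l x => ENNReal.ofReal l * Q (grainCover l x))
    (g := fun x => ENNReal.ofReal (κ x) * m) ?_ (by fun_prop) (by rw [hg]; exact hm) ?_ ?_
  · refine key.congr' ?_
    filter_upwards [eventually_gt_atTop 0] with l hl
    refine lintegral_congr fun x => ?_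
    rw [ENNReal.toReal_mul, ENNReal.toReal_mul, ENNReal.toReal_ofReal hl.le,
      ENNReal.toReal_ofReal (hκ.nonneg x), measureReal_def]
  · filter_upwards [eventually_gt_atTop 0] with l hl
    exact (hmeas l hl).const_mul _
  · filter_upwards [eventually_gt_atTop 0] with l hl
    have h := lintegral_measure_grainCover (μT := μT) hκ hd hl Set.univ
    simp only [Set.univ_prod_univ, Set.inter_univ] at h
    rw [hg, lintegral_const_mul _ (hmeas l hl), h, ← mul_assoc, ← ENNReal.ofReal_mul hl.le,
      mul_inv_cancel₀ hl.ne', ENNReal.ofReal_one, one_mul]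
  · filter_upwards [hκ.ae_continuous] with x hx
    have h1 : Tendsto (fun l : ℝ => ∫⁻ p, ENNReal.ofReal (κ (x - grainScale d l • p.2))
        ∂grainPointMeasure μT) atTop (𝓝 (∫⁻ _, ENNReal.ofReal (κ x) ∂grainPointMeasure μT)) := by
      obtain ⟨Cκ, hC⟩ := hκ.bounded
      refine tendsto_lintegral_filter_of_dominated_convergence (fun _ => ENNReal.ofReal Cκ)
        (Eventually.of_forall fun l => by fun_prop)
        (Eventually.of_forall fun l => ae_of_all _ fun p => ENNReal.ofReal_le_ofReal (hC _))
        (by rw [lintegral_const]; finiteness) (ae_of_all _ fun p => ?_)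
      refine ENNReal.tendsto_ofReal (hx.tendsto.comp ?_)
      have := tendsto_const_nhds (x := x) (f := (atTop : Filter ℝ)) |>.sub
        ((tendsto_grainScale hd).smul_const p.2)
      simpa using this
    rw [lintegral_const, grainPointMeasure_univ] at h1
    refine h1.congr' ?_
    filter_upwards [eventually_gt_atTop 0] with l hl
    rw [measure_grainCover hκ hd hl, ← mul_assoc, ← ENNReal.ofReal_mul hl.le,
      mul_inv_cancel₀ hl.ne', ENNReal.ofReal_one, one_mul]

end Intensity

/-! ### Bounds for the variance, the truncation error and the mean -/

section Estimates

variable {d : ℕ} {κ : EuclideanSpace ℝ (Fin d) → ℝ}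
  {μT : Measure (Compacts (EuclideanSpace ℝ (Fin d)))} [IsProbabilityMeasure μT]
  {Ω : Type*} [MeasurableSpace Ω] {Pr : Measure Ω} [IsProbabilityMeasure Pr]
  {N : Ω → Set (EuclideanSpace ℝ (Fin d) × Compacts (EuclideanSpace ℝ (Fin d)))}
  {l M C : ℝ} {A : Set (Compacts (EuclideanSpace ℝ (Fin d)))}
  {G G' : Set (Ω × EuclideanSpace ℝ (Fin d))} {f : EuclideanSpace ℝ (Fin d) → ℝ}

/-- The sections of the measurable set `G` are almost surely the unions of those grains of `N`
which belong to `A`. -/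
structure IsGrainSection (N : Ω → Set (EuclideanSpace ℝ (Fin d) ×
    Compacts (EuclideanSpace ℝ (Fin d)))) (l : ℝ)
    (A : Set (Compacts (EuclideanSpace ℝ (Fin d)))) (Pr : Measure Ω)
    (G : Set (Ω × EuclideanSpace ℝ (Fin d))) : Prop where
  measurableSet : MeasurableSet G
  ae_mem_iff : ∀ᵐ ω ∂Pr, ∀ x, (ω, x) ∈ G ↔ ω ∈ hitEvent N (grainCover l x ∩ Set.univ ×ˢ A)

/-- The limit of the integral of `f` over the germ-grain set. -/
noncomputable def grainLimit (κ : EuclideanSpace ℝ (Fin d) → ℝ)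
    (μT : Measure (Compacts (EuclideanSpace ℝ (Fin d)))) (f : EuclideanSpace ℝ (Fin d) → ℝ) : ℝ :=
  ∫ x, f x * (1 - Real.exp (-(κ x * (meanGrain μT Set.univ 1).toReal)))

lemma HasPoissonLikeHits.exists_isGrainSection
    (hN : HasPoissonLikeHits N M ((densityMeasure κ).prod μT) Pr) (l : ℝ)
    (hA : MeasurableSet A) : ∃ G, IsGrainSection N l A Pr G := by
  obtain ⟨G, hG, h⟩ := exists_measurableSet_section_grainUnion l hN.measurableSet_hit
    (MeasurableSet.univ.prod hA)
  refine ⟨G, hG, ?_⟩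
  filter_upwards [hN.ae_finite] with ω hω x
  rw [h ω hω x, mem_grainUnion_iff, Set.inter_assoc, Set.inter_comm (Set.univ ×ˢ A)]
  rfl

lemma IsGrainSection.ae_integral_eq (hG : IsGrainSection N l Set.univ Pr G) :
    ∀ᵐ ω ∂Pr, ∫ x in grainUnion l (N ω), f x = sectionIntegral volume G f ω := by
  filter_upwards [hG.ae_mem_iff] with ω hω
  have : grainUnion l (N ω) = {x | (ω, x) ∈ G} := by
    ext x
    rw [Set.mem_ofPred_eq, hω x, mem_grainUnion_iff, Set.univ_prod_univ, Set.inter_univ]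
    rfl
  rw [sectionIntegral, this]

lemma IsGrainSection.coverProb_eq (hG : IsGrainSection N l A Pr G)
    (x : EuclideanSpace ℝ (Fin d)) :
    coverProb Pr G x = Pr.real (hitEvent N (grainCover l x ∩ Set.univ ×ˢ A)) := by
  refine measureReal_congr ?_
  filter_upwards [hG.ae_mem_iff] with ω hω
  exact propext (hω x)

lemma measurableSet_grainCover_inter (hl : 0 < l) (hA : MeasurableSet A)
    (x : EuclideanSpace ℝ (Fin d)) : MeasurableSet (grainCover l x ∩ Set.univ ×ˢ A) :=
  (measurableSet_grainCover hl x).inter (MeasurableSet.univ.prod hA)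

lemma measurable_measure_grainCover (hκ : IsAdmissibleDensity κ) (hl : 0 < l)
    (hA : MeasurableSet A) : Measurable fun x =>
      (densityMeasure κ).prod μT (grainCover l x ∩ Set.univ ×ˢ A) := by
  have := hκ.isProbabilityMeasure
  have h : MeasurableSet {p : EuclideanSpace ℝ (Fin d) ×
      (EuclideanSpace ℝ (Fin d) × Compacts (EuclideanSpace ℝ (Fin d))) |
      p.2 ∈ grainCover l p.1 ∩ Set.univ ×ˢ A} :=
    (measurableSet_grainCover_graph hl).inter (measurable_snd (MeasurableSet.univ.prod hA))
  exact measurable_measure_prodMk_left h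

lemma HasPoissonLikeHits.measure_hit_le (hκ : IsAdmissibleDensity κ)
    (hN : HasPoissonLikeHits N M ((densityMeasure κ).prod μT) Pr)
    {B : Set (EuclideanSpace ℝ (Fin d) × Compacts (EuclideanSpace ℝ (Fin d)))}
    (hB : MeasurableSet B) :
    Pr (hitEvent N B) ≤ ENNReal.ofReal M * (densityMeasure κ).prod μT B := by
  have := hκ.isProbabilityMeasure
  rw [← ofReal_measureReal (μ := Pr), ← ofReal_measureReal (μ := (densityMeasure κ).prod μT),
    ← ENNReal.ofReal_mul hN.intensity_nonneg]
  exact ENNReal.ofReal_le_ofReal (hN.hit_le B hB)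

lemma HasPoissonLikeHits.lintegral_hit_le (hκ : IsAdmissibleDensity κ) (hd : 1 ≤ d)
    (hN : HasPoissonLikeHits N M ((densityMeasure κ).prod μT) Pr) (hl : 0 < l)
    (hA : MeasurableSet A) :
    ∫⁻ x, Pr (hitEvent N (grainCover l x ∩ Set.univ ×ˢ A))
      ≤ ENNReal.ofReal M * (ENNReal.ofReal l⁻¹ * meanGrain μT A 1) := by
  rw [← lintegral_measure_grainCover hκ hd hl, ← lintegral_const_mul' _ _ ENNReal.ofReal_ne_top]
  exact lintegral_mono fun x => hN.measure_hit_le hκ (measurableSet_grainCover_inter hl hA x)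

lemma meanGrain_mono {A' : Set (Compacts (EuclideanSpace ℝ (Fin d)))} (h : A ⊆ A') (k : ℕ) :
    meanGrain μT A k ≤ meanGrain μT A' k :=
  lintegral_mono_set h

lemma IsGrainSection.lintegral_section_ne_top (hG : IsGrainSection N l A Pr G)
    (hκ : IsAdmissibleDensity κ) (hd : 1 ≤ d)
    (hN : HasPoissonLikeHits N M ((densityMeasure κ).prod μT) Pr) (hl : 0 < l)
    (hA : MeasurableSet A) (hm : meanGrain μT Set.univ 1 ≠ ∞) :
    ∫⁻ x, Pr {ω | (ω, x) ∈ G} ≠ ∞ := by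
  have hmA : meanGrain μT A 1 ≠ ∞ := ne_top_of_le_ne_top hm (meanGrain_mono (Set.subset_univ A) 1)
  refine ne_top_of_le_ne_top ?_ (le_trans (le_of_eq ?_) (hN.lintegral_hit_le hκ hd hl hA))
  · finiteness
  · refine lintegral_congr fun x => measure_congr ?_
    filter_upwards [hG.ae_mem_iff] with ω hω
    exact propext (hω x)

lemma IsGrainSection.eLpNorm_sub_integral_le (hG : IsGrainSection N l A Pr G)
    (hκ : IsAdmissibleDensity κ) (hd : 1 ≤ d)
    (hN : HasPoissonLikeHits N M ((densityMeasure κ).prod μT) Pr) (hl : 0 < l)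
    (hA : MeasurableSet A) (hm : meanGrain μT Set.univ 1 ≠ ∞) (hm2 : meanGrain μT A 2 ≠ ∞)
    (hf : Measurable f) (hC : ∀ x, |f x| ≤ C) (hC0 : 0 ≤ C) :
    eLpNorm (fun ω => sectionIntegral volume G f ω - ∫ ω', sectionIntegral volume G f ω' ∂Pr) 2 Pr
      ≤ ENNReal.ofReal C * (ENNReal.ofReal (M * l⁻¹ ^ 2) *
        (meanGrain μT A 2 + meanGrain μT Set.univ 1 ^ 2)) ^ (1 / 2 : ℝ) := by
  have := hκ.isProbabilityMeasure
  set Q := (densityMeasure κ).prod μT with hQ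
  have hM := hN.intensity_nonneg
  set B := fun x => grainCover l x ∩ Set.univ ×ˢ A with hBdef
  have hB : ∀ x, MeasurableSet (B x) := measurableSet_grainCover_inter hl hA
  have hQB := measurable_measure_grainCover (μT := μT) hκ hl hA
  -- This is the covariance bound for the events that `x` and `y` are covered. Its first term
  -- integrates to a squared first moment, its second to the truncated second moment.
  set R : EuclideanSpace ℝ (Fin d) × EuclideanSpace ℝ (Fin d) → ℝ≥0∞ := fun p =>
    ENNReal.ofReal M * (Q (B p.1) * Q (B p.2) +
      Q (grainCover l p.1 ∩ grainCover l p.2 ∩ Set.univ ×ˢ A)) with hRdef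
  have hRint : ∫⁻ p, R p ∂(volume.prod volume) ≤ ENNReal.ofReal (M * l⁻¹ ^ 2) *
        (meanGrain μT A 2 + meanGrain μT Set.univ 1 ^ 2) := by
    have hmeas : Measurable fun p : EuclideanSpace ℝ (Fin d) × EuclideanSpace ℝ (Fin d) =>
        Q (B p.1) * Q (B p.2) := (hQB.comp measurable_fst).mul (hQB.comp measurable_snd)
    rw [hRdef, lintegral_const_mul' _ _ ENNReal.ofReal_ne_top, lintegral_add_left hmeas,
      lintegral_prod_mul hQB.aemeasurable hQB.aemeasurable,
      lintegral_measure_grainCover hκ hd hl, ← Measure.volume_eq_prod,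
      lintegral_measure_grainCover_inter hκ hd hl, ENNReal.ofReal_mul hM,
      ENNReal.ofReal_pow (by positivity), mul_assoc (ENNReal.ofReal M)]
    refine mul_le_mul_right ?_ _
    calc ENNReal.ofReal l⁻¹ * meanGrain μT A 1 * (ENNReal.ofReal l⁻¹ * meanGrain μT A 1)
          + ENNReal.ofReal l⁻¹ ^ 2 * meanGrain μT A 2
        = ENNReal.ofReal l⁻¹ ^ 2 * (meanGrain μT A 2 + meanGrain μT A 1 ^ 2) := by ring
      _ ≤ ENNReal.ofReal l⁻¹ ^ 2 * (meanGrain μT A 2 + meanGrain μT Set.univ 1 ^ 2) := by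
        gcongr
        exact meanGrain_mono (Set.subset_univ A) 1
  refine (eLpNorm_two_sectionIntegral_sub_le hG.measurableSet hf hC hC0
    (hG.lintegral_section_ne_top hκ hd hN hl hA hm) R
    (ne_top_of_le_ne_top (by finiteness) hRint) fun x y => ?_).trans ?_
  · have h1 : Pr.real {ω | (ω, x) ∈ G ∧ (ω, y) ∈ G}
        = Pr.real (hitEvent N (B x) ∩ hitEvent N (B y)) := by
      refine measureReal_congr ?_
      filter_upwards [hG.ae_mem_iff] with ω hω
      exact propext (and_congr (hω x) (hω y))
    have hxy : B x ∩ B y = grainCover l x ∩ grainCover l y ∩ Set.univ ×ˢ A :=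
      (Set.inter_inter_distrib_right _ _ _).symm
    rw [h1, hG.coverProb_eq, hG.coverProb_eq]
    refine (ENNReal.ofReal_le_ofReal (hN.abs_cov_le _ _ (hB x) (hB y))).trans (le_of_eq ?_)
    rw [hxy, ENNReal.ofReal_mul hM, ENNReal.ofReal_add measureReal_nonneg (by positivity),
      ENNReal.ofReal_mul measureReal_nonneg, ofReal_measureReal, ofReal_measureReal,
      ofReal_measureReal, add_comm]
  · gcongr

/-- A point covered by some grain but by none in `A` is covered by a grain in `Aᶜ`, and the expected
volume covered by those is at most `M l⁻¹` times their mean volume. -/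
lemma IsGrainSection.lintegral_enorm_sub_le (hG : IsGrainSection N l Set.univ Pr G)
    (hG' : IsGrainSection N l A Pr G') (hκ : IsAdmissibleDensity κ) (hd : 1 ≤ d)
    (hN : HasPoissonLikeHits N M ((densityMeasure κ).prod μT) Pr) (hl : 0 < l)
    (hA : MeasurableSet A) (hm : meanGrain μT Set.univ 1 ≠ ∞)
    (hf : Measurable f) (hC : ∀ x, |f x| ≤ C) :
    ∫⁻ ω, ‖sectionIntegral volume G f ω - sectionIntegral volume G' f ω‖ₑ ∂Pr
      ≤ ENNReal.ofReal C * (ENNReal.ofReal (M * l⁻¹) * meanGrain μT Aᶜ 1) := by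
  refine (lintegral_enorm_sectionIntegral_sub_le hG.measurableSet hG'.measurableSet hf hC
    (hG.lintegral_section_ne_top hκ hd hN hl MeasurableSet.univ hm) ?_).trans ?_
  · filter_upwards [hG.ae_mem_iff, hG'.ae_mem_iff] with ω hω hω' x hx
    obtain ⟨z, hz, hzc, -⟩ := (hω' x).1 hx
    exact (hω x).2 ⟨z, hz, hzc, by simp⟩
  · gcongr
    rw [ENNReal.ofReal_mul hN.intensity_nonneg, mul_assoc]
    refine le_trans (lintegral_mono fun x => measure_mono_ae ?_)
      (hN.lintegral_hit_le hκ hd hl hA.compl)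
    filter_upwards [hG.ae_mem_iff, hG'.ae_mem_iff] with ω hω hω' hx
    obtain ⟨z, hz, hzc, -⟩ := (hω x).1 hx.1
    refine ⟨z, hz, hzc, trivial, fun hzA => hx.2 ((hω' x).2 ⟨z, hz, hzc, trivial, hzA⟩)⟩

/-- An upper bound for the distance between the coverage function of the germ-grain set and its
limit. -/
noncomputable def meanError (κ : EuclideanSpace ℝ (Fin d) → ℝ)
    (μT : Measure (Compacts (EuclideanSpace ℝ (Fin d)))) (Cκ l M : ℝ) : ℝ≥0∞ :=
  ENNReal.ofReal (M * l⁻¹ ^ 2) *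
      (ENNReal.ofReal Cκ * meanGrain μT Set.univ 1 * meanGrain μT Set.univ 1)
    + ENNReal.ofReal (|M - l| * l⁻¹) * meanGrain μT Set.univ 1
    + ∫⁻ x, ENNReal.ofReal |l * ((densityMeasure κ).prod μT).real (grainCover l x)
        - κ x * (meanGrain μT Set.univ 1).toReal|

lemma abs_exp_neg_sub_exp_neg_le {a b : ℝ} (ha : 0 ≤ a) (hb : 0 ≤ b) :
    |Real.exp (-a) - Real.exp (-b)| ≤ |a - b| := by
  wlog h : a ≤ b generalizing a b
  · rw [abs_sub_comm, abs_sub_comm a]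
    exact this hb ha (le_of_not_ge h)
  have h1 : Real.exp (-b) = Real.exp (-a) * Real.exp (-(b - a)) := by
    rw [← Real.exp_add]; ring_nf
  have h2 := Real.add_one_le_exp (-(b - a))
  have h3 : Real.exp (-a) ≤ 1 := Real.exp_le_one_iff.2 (by linarith)
  have h4 : Real.exp (-(b - a)) ≤ 1 := Real.exp_le_one_iff.2 (by linarith)
  have h5 := Real.exp_pos (-a)
  rw [abs_of_nonpos (sub_nonpos.2 h), abs_of_nonneg (by rw [h1]; nlinarith), h1]
  nlinarith

/-- The three terms of `meanError` are the Poisson approximation error `M * b ^ 2`, the replacement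
of `M` by `l`, and the convergence of the rescaled intensity. In the first, one factor `b` is
bounded uniformly in `x` through the bound on `κ`, and the other is integrated. -/
lemma HasPoissonLikeHits.lintegral_abs_hit_sub_le (hκ : IsAdmissibleDensity κ) (hd : 1 ≤ d)
    (hN : HasPoissonLikeHits N M ((densityMeasure κ).prod μT) Pr) (hl : 0 < l)
    {Cκ : ℝ} (hCκ : ∀ x, κ x ≤ Cκ) :
    ∫⁻ x, ENNReal.ofReal |Pr.real (hitEvent N (grainCover l x))
      - (1 - Real.exp (-(κ x * (meanGrain μT Set.univ 1).toReal)))|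
      ≤ meanError κ μT Cκ l M := by
  have := hκ.isProbabilityMeasure
  have hM := hN.intensity_nonneg
  set Q := (densityMeasure κ).prod μT with hQ
  set m := meanGrain μT Set.univ 1 with hmdef
  have hint := lintegral_measure_grainCover (μT := μT) hκ hd hl Set.univ
  have hQm := measurable_measure_grainCover (μT := μT) hκ hl MeasurableSet.univ
  simp only [Set.univ_prod_univ, Set.inter_univ] at hint hQm
  have hQle := measure_grainCover_le (μT := μT) hκ hd hl hCκ
  have hpt : ∀ x, ENNReal.ofReal |Pr.real (hitEvent N (grainCover l x))
      - (1 - Real.exp (-(κ x * m.toReal)))|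
      ≤ ENNReal.ofReal M * (ENNReal.ofReal l⁻¹ * (ENNReal.ofReal Cκ * m)) * Q (grainCover l x)
        + ENNReal.ofReal |M - l| * Q (grainCover l x)
        + ENNReal.ofReal |l * Q.real (grainCover l x) - κ x * m.toReal| := fun x => by
    set b := Q.real (grainCover l x) with hb
    have hb0 : 0 ≤ b := measureReal_nonneg
    have h1 := hN.abs_hit_sub_le _ (measurableSet_grainCover hl x)
    have h2 := abs_exp_neg_sub_exp_neg_le (mul_nonneg hM hb0)
      (mul_nonneg (hκ.nonneg x) (ENNReal.toReal_nonneg (a := m)))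
    have h3 : |M * b - κ x * m.toReal| ≤ |M - l| * b + |l * b - κ x * m.toReal| := by
      rw [show M * b - κ x * m.toReal = (M - l) * b + (l * b - κ x * m.toReal) by ring]
      exact (abs_add_le _ _).trans_eq (by rw [abs_mul, abs_of_nonneg hb0])
    have h4 : |Pr.real (hitEvent N (grainCover l x)) - (1 - Real.exp (-(κ x * m.toReal)))|
        ≤ M * b ^ 2 + |M - l| * b + |l * b - κ x * m.toReal| := by
      have := abs_sub_le (Pr.real (hitEvent N (grainCover l x))) (1 - Real.exp (-(M * b)))
        (1 - Real.exp (-(κ x * m.toReal)))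
      rw [sub_sub_sub_cancel_left, abs_sub_comm (Real.exp _)] at this
      linarith
    refine (ENNReal.ofReal_le_ofReal h4).trans ?_
    rw [ENNReal.ofReal_add (by positivity) (abs_nonneg _),
      ENNReal.ofReal_add (by positivity) (by positivity), ENNReal.ofReal_mul hM,
      ENNReal.ofReal_mul (abs_nonneg _), sq, ENNReal.ofReal_mul hb0, hb, ofReal_measureReal,
      ← mul_assoc]
    gcongr
    exact hQle x
  refine (lintegral_mono hpt).trans (le_of_eq ?_)
  have hm1 : Measurable fun x => ENNReal.ofReal M *
    (ENNReal.ofReal l⁻¹ * (ENNReal.ofReal Cκ * m)) * Q (grainCover l x) := hQm.const_mul _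
  have hm2 : Measurable fun x => ENNReal.ofReal |M - l| * Q (grainCover l x) := hQm.const_mul _
  have hm3 : Measurable fun x => ENNReal.ofReal M *
    (ENNReal.ofReal l⁻¹ * (ENNReal.ofReal Cκ * m)) * Q (grainCover l x)
      + ENNReal.ofReal |M - l| * Q (grainCover l x) := hm1.add hm2
  rw [lintegral_add_left hm3, lintegral_add_left hm1, lintegral_const_mul _ hQm,
    lintegral_const_mul _ hQm, hint, meanError, ENNReal.ofReal_mul hM,
    ENNReal.ofReal_mul (abs_nonneg _), ENNReal.ofReal_pow (by positivity)]
  ring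

lemma IsAdmissibleDensity.integrable (hκ : IsAdmissibleDensity κ) : Integrable κ := by
  refine ⟨hκ.measurable.aestronglyMeasurable, ?_⟩
  rw [hasFiniteIntegral_iff_ofReal (ae_of_all _ hκ.nonneg), hκ.lintegral_eq_one]
  exact ENNReal.one_lt_top

lemma IsGrainSection.enorm_integral_sub_le (hG : IsGrainSection N l Set.univ Pr G)
    (hκ : IsAdmissibleDensity κ) (hd : 1 ≤ d)
    (hN : HasPoissonLikeHits N M ((densityMeasure κ).prod μT) Pr) (hl : 0 < l)
    (hm : meanGrain μT Set.univ 1 ≠ ∞)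
    {Cκ : ℝ} (hCκ : ∀ x, κ x ≤ Cκ) (hf : Measurable f) (hC : ∀ x, |f x| ≤ C) :
    ‖∫ ω, sectionIntegral volume G f ω ∂Pr - grainLimit κ μT f‖ₑ
      ≤ ENNReal.ofReal C * meanError κ μT Cκ l M := by
  set m := (meanGrain μT Set.univ 1).toReal with hmdef
  have hfin := hG.lintegral_section_ne_top hκ hd hN hl MeasurableSet.univ hm
  have hκm := hκ.measurable
  have hint : Integrable fun x => f x * (1 - Real.exp (-(κ x * m))) := by
    refine Integrable.bdd_mul (c := C) ?_ hf.aestronglyMeasurable (ae_of_all _ hC)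
    refine (hκ.integrable.mul_const m).mono' (by fun_prop) (ae_of_all _ fun x => ?_)
    have h0 : 0 ≤ κ x * m := mul_nonneg (hκ.nonneg x) ENNReal.toReal_nonneg
    rw [Real.norm_eq_abs, abs_of_nonneg (by simpa using h0)]
    linarith [Real.add_one_le_exp (-(κ x * m))]
  rw [integral_sectionIntegral hG.measurableSet hf hC hfin, grainLimit,
    ← integral_sub (integrable_mul_coverProb hG.measurableSet hf hC hfin) hint]
  refine (enorm_integral_le_lintegral_enorm _).trans ?_
  refine le_trans ?_ (mul_le_mul_right (hN.lintegral_abs_hit_sub_le hκ hd hl hCκ) _)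
  rw [← lintegral_const_mul' _ _ ENNReal.ofReal_ne_top]
  refine lintegral_mono fun x => ?_
  rw [← mul_sub, enorm_mul, ← ofReal_norm, ← ofReal_norm, hG.coverProb_eq, Set.univ_prod_univ,
    Set.inter_univ]
  exact mul_le_mul' (ENNReal.ofReal_le_ofReal (hC x)) le_rfl

end Estimates

/-! ### Convergence in L² and, by truncation, in L¹ -/

section Convergence

variable {d : ℕ} {κ : EuclideanSpace ℝ (Fin d) → ℝ}
  {μT : Measure (Compacts (EuclideanSpace ℝ (Fin d)))} [IsProbabilityMeasure μT]
  {Ω : Type*} [MeasurableSpace Ω] {Pr : Measure Ω} [IsProbabilityMeasure Pr]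
  {f : EuclideanSpace ℝ (Fin d) → ℝ}

/-- The bound on the standard deviation of the integral over the grains belonging to `A`. -/
noncomputable def deviationBound (μT : Measure (Compacts (EuclideanSpace ℝ (Fin d))))
    (A : Set (Compacts (EuclideanSpace ℝ (Fin d)))) (l M : ℝ) : ℝ≥0∞ :=
  (ENNReal.ofReal (M * l⁻¹ ^ 2) *
    (meanGrain μT A 2 + meanGrain μT Set.univ 1 ^ 2)) ^ (1 / 2 : ℝ)

lemma HasPoissonLikeHits.aestronglyMeasurable_integral
    {N : Ω → Set (EuclideanSpace ℝ (Fin d) × Compacts (EuclideanSpace ℝ (Fin d)))} {M : ℝ}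
    (hN : HasPoissonLikeHits N M ((densityMeasure κ).prod μT) Pr) (l : ℝ) (hf : Measurable f) :
    AEStronglyMeasurable (fun ω => ∫ x in grainUnion l (N ω), f x) Pr := by
  obtain ⟨G, hG⟩ := hN.exists_isGrainSection l MeasurableSet.univ
  exact (stronglyMeasurable_sectionIntegral hG.measurableSet hf).aestronglyMeasurable.congr
    (hG.ae_integral_eq.mono fun _ h => h.symm)

theorem HasPoissonLikeHits.eLpNorm_two_integral_sub_le (hκ : IsAdmissibleDensity κ) (hd : 1 ≤ d)
    {N : Ω → Set (EuclideanSpace ℝ (Fin d) × Compacts (EuclideanSpace ℝ (Fin d)))} {l M C : ℝ}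
    (hN : HasPoissonLikeHits N M ((densityMeasure κ).prod μT) Pr) (hl : 0 < l)
    (hm : meanGrain μT Set.univ 1 ≠ ∞) (hm2 : meanGrain μT Set.univ 2 ≠ ∞)
    {Cκ : ℝ} (hCκ : ∀ x, κ x ≤ Cκ) (hf : Measurable f) (hC : ∀ x, |f x| ≤ C) (hC0 : 0 ≤ C) :
    eLpNorm (fun ω => (∫ x in grainUnion l (N ω), f x) - grainLimit κ μT f) 2 Pr
      ≤ ENNReal.ofReal C * (deviationBound μT Set.univ l M + meanError κ μT Cκ l M) := by
  obtain ⟨G, hG⟩ := hN.exists_isGrainSection l MeasurableSet.univ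
  have hZ := (stronglyMeasurable_sectionIntegral (ν := volume) hG.measurableSet
    hf).aestronglyMeasurable (μ := Pr)
  set Z := sectionIntegral volume G f
  set c := grainLimit κ μT f
  have h : (fun ω => (∫ x in grainUnion l (N ω), f x) - c) =ᵐ[Pr]
      (fun ω => Z ω - ∫ ω', Z ω' ∂Pr) + fun _ => ∫ ω', Z ω' ∂Pr - c := by
    filter_upwards [hG.ae_integral_eq] with ω hω
    rw [hω, Pi.add_apply]
    ring
  rw [eLpNorm_congr_ae h]
  refine (eLpNorm_add_le (hZ.sub aestronglyMeasurable_const) aestronglyMeasurable_const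
    (by norm_num)).trans ?_
  rw [eLpNorm_const _ (by norm_num) (NeZero.ne Pr), measure_univ, ENNReal.one_rpow, mul_one,
    mul_add]
  exact add_le_add (hG.eLpNorm_sub_integral_le hκ hd hN hl MeasurableSet.univ hm hm2 hf hC hC0)
    (hG.enorm_integral_sub_le hκ hd hN hl hm hCκ hf hC)

theorem HasPoissonLikeHits.eLpNorm_one_integral_sub_le (hκ : IsAdmissibleDensity κ) (hd : 1 ≤ d)
    {N : Ω → Set (EuclideanSpace ℝ (Fin d) × Compacts (EuclideanSpace ℝ (Fin d)))} {l M C : ℝ}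
    (hN : HasPoissonLikeHits N M ((densityMeasure κ).prod μT) Pr) (hl : 0 < l)
    (hm : meanGrain μT Set.univ 1 ≠ ∞) {A : Set (Compacts (EuclideanSpace ℝ (Fin d)))}
    (hA : MeasurableSet A) (hm2 : meanGrain μT A 2 ≠ ∞)
    {Cκ : ℝ} (hCκ : ∀ x, κ x ≤ Cκ) (hf : Measurable f) (hC : ∀ x, |f x| ≤ C) (hC0 : 0 ≤ C) :
    eLpNorm (fun ω => (∫ x in grainUnion l (N ω), f x) - grainLimit κ μT f) 1 Pr
      ≤ ENNReal.ofReal C * (2 * (ENNReal.ofReal (M * l⁻¹) * meanGrain μT Aᶜ 1)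
        + deviationBound μT A l M + meanError κ μT Cκ l M) := by
  obtain ⟨G, hG⟩ := hN.exists_isGrainSection l MeasurableSet.univ
  obtain ⟨G', hG'⟩ := hN.exists_isGrainSection l hA
  have hZ := (stronglyMeasurable_sectionIntegral (ν := volume) hG.measurableSet
    hf).aestronglyMeasurable (μ := Pr)
  have hZ' := (stronglyMeasurable_sectionIntegral (ν := volume) hG'.measurableSet
    hf).aestronglyMeasurable (μ := Pr)
  have hZi := integrable_sectionIntegral hG.measurableSet hf hC
    (hG.lintegral_section_ne_top hκ hd hN hl MeasurableSet.univ hm)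
  have hZi' := integrable_sectionIntegral hG'.measurableSet hf hC
    (hG'.lintegral_section_ne_top hκ hd hN hl hA hm)
  have hdiff := hG.lintegral_enorm_sub_le hG' hκ hd hN hl hA hm hf hC
  have hdev := hG'.eLpNorm_sub_integral_le hκ hd hN hl hA hm hm2 hf hC hC0
  have herr := hG.enorm_integral_sub_le hκ hd hN hl hm hCκ hf hC
  set Z := sectionIntegral volume G f
  set Z' := sectionIntegral volume G' f
  set c := grainLimit κ μT f
  set e := ∫ ω, Z ω ∂Pr
  set e' := ∫ ω, Z' ω ∂Pr
  have hee : ‖e' - e‖ₑ ≤ ENNReal.ofReal C * (ENNReal.ofReal (M * l⁻¹) * meanGrain μT Aᶜ 1) := by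
    rw [← enorm_neg, neg_sub, ← integral_sub hZi hZi']
    exact (enorm_integral_le_lintegral_enorm _).trans hdiff
  -- The truncation error occurs twice, once for the variables and once for their means, hence the
  -- factor 2. The mean is compared with `c` for the full set `Z`, so the limit does not depend on
  -- `A`.
  have h : (fun ω => (∫ x in grainUnion l (N ω), f x) - c) =ᵐ[Pr]
      (fun ω => Z ω - Z' ω) + ((fun ω => Z' ω - e') + fun _ => (e' - e) + (e - c)) := by
    filter_upwards [hG.ae_integral_eq] with ω hω
    rw [hω]
    simp only [Pi.add_apply]
    ring
  have hcm : AEStronglyMeasurable (fun _ : Ω => (e' - e) + (e - c)) Pr :=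
    aestronglyMeasurable_const
  have hdm : AEStronglyMeasurable (fun ω => Z' ω - e') Pr := hZ'.sub aestronglyMeasurable_const
  rw [eLpNorm_congr_ae h]
  refine (eLpNorm_add_le (hZ.sub hZ') (hdm.add hcm) le_rfl).trans ?_
  refine (add_le_add le_rfl (eLpNorm_add_le hdm hcm le_rfl)).trans ?_
  rw [eLpNorm_const _ (by norm_num) (NeZero.ne Pr), measure_univ, ENNReal.one_rpow, mul_one,
    eLpNorm_one_eq_lintegral_enorm]
  refine (add_le_add hdiff (add_le_add
    ((eLpNorm_le_eLpNorm_of_exponent_le (by norm_num) hdm).trans hdev)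
    ((enorm_add_le _ _).trans (add_le_add hee herr)))).trans (le_of_eq ?_)
  rw [deviationBound]
  ring

variable {ι : Type*} {L : Filter ι} {l M : ι → ℝ}

lemma tendsto_mul_inv_sq (hl : Tendsto l L atTop) (hM : Tendsto (fun i => M i * (l i)⁻¹) L (𝓝 1)) :
    Tendsto (fun i => ENNReal.ofReal (M i * (l i)⁻¹ ^ 2)) L (𝓝 0) := by
  have h := ENNReal.tendsto_ofReal (hM.mul (tendsto_inv_atTop_zero.comp hl))
  simp only [mul_zero, ENNReal.ofReal_zero] at h
  refine h.congr fun i => ?_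
  simp only [Function.comp_apply]
  ring_nf

lemma tendsto_deviationBound (hl : Tendsto l L atTop)
    (hM : Tendsto (fun i => M i * (l i)⁻¹) L (𝓝 1))
    (hm : meanGrain μT Set.univ 1 ≠ ∞) {A : Set (Compacts (EuclideanSpace ℝ (Fin d)))}
    (hm2 : meanGrain μT A 2 ≠ ∞) :
    Tendsto (fun i => deviationBound μT A (l i) (M i)) L (𝓝 0) := by
  have h := ENNReal.Tendsto.mul_const (b := meanGrain μT A 2 + meanGrain μT Set.univ 1 ^ 2)
    (tendsto_mul_inv_sq hl hM) (Or.inr (by finiteness))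
  rw [zero_mul] at h
  have h' := h.ennrpow_const (1 / 2 : ℝ)
  rwa [ENNReal.zero_rpow_of_pos (by norm_num)] at h'

lemma tendsto_meanError (hκ : IsAdmissibleDensity κ) (hd : 1 ≤ d) (hl : Tendsto l L atTop)
    (hM : Tendsto (fun i => M i * (l i)⁻¹) L (𝓝 1))
    (hm : meanGrain μT Set.univ 1 ≠ ∞) (Cκ : ℝ) :
    Tendsto (fun i => meanError κ μT Cκ (l i) (M i)) L (𝓝 0) := by
  have h1 := ENNReal.Tendsto.mul_const
    (b := ENNReal.ofReal Cκ * meanGrain μT Set.univ 1 * meanGrain μT Set.univ 1)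
    (tendsto_mul_inv_sq hl hM) (Or.inr (by finiteness))
  have h2 : Tendsto (fun i => ENNReal.ofReal (|M i - l i| * (l i)⁻¹)) L (𝓝 0) := by
    have h := ENNReal.tendsto_ofReal (hM.sub_const 1).abs
    rw [sub_self, abs_zero, ENNReal.ofReal_zero] at h
    refine h.congr' ?_
    filter_upwards [hl.eventually_gt_atTop 0] with i hi
    rw [← abs_of_pos (inv_pos.2 hi), ← abs_mul, abs_of_pos (inv_pos.2 hi), sub_mul,
      mul_inv_cancel₀ hi.ne']
  have h3 := ENNReal.Tendsto.mul_const (b := meanGrain μT Set.univ 1) h2 (Or.inr hm)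
  have h4 := (tendsto_lintegral_measure_grainCover_sub hκ hd hm).comp hl
  have h5 := (h1.add h3).add h4
  rw [zero_mul, zero_mul, add_zero, add_zero] at h5
  exact h5

lemma meanGrain_ne_top {k : ℕ} {p : ℝ} (hk : (k : ℝ) ≤ p)
    (hT : ∫⁻ t : Compacts (EuclideanSpace ℝ (Fin d)),
      volume (t : Set (EuclideanSpace ℝ (Fin d))) ^ p ∂μT < ∞) :
    meanGrain μT Set.univ k ≠ ∞ := by
  have hle : meanGrain μT Set.univ k ≤ ∫⁻ t : Compacts (EuclideanSpace ℝ (Fin d)),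
      (1 + volume (t : Set (EuclideanSpace ℝ (Fin d))) ^ p) ∂μT := by
    rw [meanGrain, Measure.restrict_univ]
    refine lintegral_mono fun t => ?_
    rcases le_total (volume (t : Set (EuclideanSpace ℝ (Fin d)))) 1 with h | h
    · exact (pow_le_one₀ zero_le h).trans le_self_add
    · rw [← ENNReal.rpow_natCast]
      exact (ENNReal.rpow_le_rpow_of_exponent_le h hk).trans le_add_self
  refine ne_top_of_le_ne_top ?_ hle
  rw [lintegral_add_left measurable_const]
  simpa using hT.ne

lemma measurableSet_volume_le (d K : ℕ) :
    MeasurableSet {t : Compacts (EuclideanSpace ℝ (Fin d)) |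
      volume (t : Set (EuclideanSpace ℝ (Fin d))) ≤ K} :=
  measurableSet_le (measurable_volume_compacts d) measurable_const

/-- On the truncated set `‖t‖² ≤ K ‖t‖`, so a finite first moment suffices for the variance bound.
-/
lemma meanGrain_two_volume_le_ne_top (hm : meanGrain μT Set.univ 1 ≠ ∞) (K : ℕ) :
    meanGrain μT {t | volume (t : Set (EuclideanSpace ℝ (Fin d))) ≤ K} 2 ≠ ∞ := by
  have hle : meanGrain μT {t | volume (t : Set (EuclideanSpace ℝ (Fin d))) ≤ K} 2
      ≤ K * meanGrain μT Set.univ 1 := by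
    calc meanGrain μT {t | volume (t : Set (EuclideanSpace ℝ (Fin d))) ≤ K} 2
        ≤ ∫⁻ t in {t | volume (t : Set (EuclideanSpace ℝ (Fin d))) ≤ K},
            K * volume (t : Set (EuclideanSpace ℝ (Fin d))) ^ 1 ∂μT := by
          refine setLIntegral_mono' (measurableSet_volume_le d K) fun t ht => ?_
          rw [sq, pow_one]
          exact mul_le_mul_left ht _
      _ = K * meanGrain μT {t | volume (t : Set (EuclideanSpace ℝ (Fin d))) ≤ K} 1 :=
          lintegral_const_mul' _ _ (ENNReal.natCast_ne_top K)
      _ ≤ K * meanGrain μT Set.univ 1 := by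
          gcongr
          exact meanGrain_mono (Set.subset_univ _) 1
  exact ne_top_of_le_ne_top (by finiteness) hle

lemma tendsto_meanGrain_compl_volume_le (hm : meanGrain μT Set.univ 1 ≠ ∞) :
    Tendsto (fun K : ℕ => meanGrain μT
      {t | volume (t : Set (EuclideanSpace ℝ (Fin d))) ≤ K}ᶜ 1) atTop (𝓝 0) := by
  have hvm := (measurable_volume_compacts d).pow_const 1
  have hAm := fun K => (measurableSet_volume_le d K).compl
  have h := tendsto_lintegral_filter_of_dominated_convergence (l := (atTop : Filter ℕ)) (μ := μT)
    (F := fun K => ({t : Compacts (EuclideanSpace ℝ (Fin d)) |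
      volume (t : Set (EuclideanSpace ℝ (Fin d))) ≤ K}ᶜ).indicator
      fun t => volume (t : Set (EuclideanSpace ℝ (Fin d))) ^ 1) (f := fun _ => 0)
    (fun t => volume (t : Set (EuclideanSpace ℝ (Fin d))) ^ 1)
    (Eventually.of_forall fun K => hvm.indicator (hAm K))
    (Eventually.of_forall fun K => ae_of_all _ fun t => Set.indicator_le_self _ _ t)
    (by rwa [meanGrain, Measure.restrict_univ] at hm) (ae_of_all _ fun t => ?_)
  · rw [lintegral_zero] at h
    refine h.congr fun K => ?_
    rw [lintegral_indicator (hAm K), meanGrain]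
  · obtain ⟨K₀, hK₀⟩ := ENNReal.exists_nat_gt (t.isCompact.measure_lt_top (μ := volume)).ne
    refine tendsto_const_nhds.congr' ?_
    filter_upwards [eventually_ge_atTop K₀] with K hK
    have ht : volume (t : Set (EuclideanSpace ℝ (Fin d))) ≤ K :=
      hK₀.le.trans (by exact_mod_cast hK)
    have hmem : t ∉ {t : Compacts (EuclideanSpace ℝ (Fin d)) |
        volume (t : Set (EuclideanSpace ℝ (Fin d))) ≤ K}ᶜ := Set.notMem_compl_iff.2 ht
    exact (Set.indicator_of_notMem hmem
      fun t => volume (t : Set (EuclideanSpace ℝ (Fin d))) ^ 1).symm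

/-- If `N i` has hitting probabilities like a Poisson process with intensity `M i • Q`, and
`l i → ∞` with `M i / l i → 1`, then the integral of a bounded function over the germ-grain set
converges in `L^q`. -/
theorem convergesInLq_integral_grainUnion (hd : 1 ≤ d) (hκ : IsAdmissibleDensity κ)
    {q : ℕ} (hq : q = 1 ∨ q = 2) {p : ℝ} (hp : (q : ℝ) < p)
    (hT : ∫⁻ t : Compacts (EuclideanSpace ℝ (Fin d)),
      volume (t : Set (EuclideanSpace ℝ (Fin d))) ^ p ∂μT < ∞)
    (hf : Measurable f) (hfb : ∃ C : ℝ, ∀ x, |f x| ≤ C)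
    {N : ι → Ω → Set (EuclideanSpace ℝ (Fin d) × Compacts (EuclideanSpace ℝ (Fin d)))}
    (hN : ∀ᶠ i in L, HasPoissonLikeHits (N i) (M i) ((densityMeasure κ).prod μT) Pr)
    (hl : Tendsto l L atTop) (hM : Tendsto (fun i => M i * (l i)⁻¹) L (𝓝 1)) :
    ConvergesInLq (fun i ω => ∫ x in grainUnion (l i) (N i ω), f x) L (grainLimit κ μT f) q Pr := by
  obtain ⟨C, hC⟩ := hfb
  have hC0 : 0 ≤ C := (abs_nonneg _).trans (hC 0)
  obtain ⟨Cκ, hCκ⟩ := hκ.bounded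
  have hm : meanGrain μT Set.univ 1 ≠ ∞ := meanGrain_ne_top (p := p)
    (by rcases hq with rfl | rfl <;> norm_num at hp ⊢ <;> linarith) hT
  have hlim : Tendsto (fun i => eLpNorm (fun ω => (∫ x in grainUnion (l i) (N i ω), f x)
      - grainLimit κ μT f) q Pr) L (𝓝 0) := by
    rcases hq with rfl | rfl
    · rw [ENNReal.tendsto_nhds_zero]
      intro ε hε
      -- The 4 is the factor 2 of the truncation error times the eventual bound `M i / l i ≤ 2`.
      -- Since `K` does not depend on `i`, the remaining errors can then be made small for fixed
      -- `K`.
      have htail := ENNReal.Tendsto.const_mul (a := ENNReal.ofReal C * 4)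
        (tendsto_meanGrain_compl_volume_le hm) (Or.inr (by finiteness))
      rw [mul_zero, ENNReal.tendsto_nhds_zero] at htail
      obtain ⟨K, hK⟩ := (htail (ε / 2) (ENNReal.half_pos hε.ne')).exists
      set A := {t : Compacts (EuclideanSpace ℝ (Fin d)) |
        volume (t : Set (EuclideanSpace ℝ (Fin d))) ≤ K}
      have hm2 : meanGrain μT A 2 ≠ ∞ := meanGrain_two_volume_le_ne_top hm K
      have hsum := ENNReal.Tendsto.const_mul (a := ENNReal.ofReal C)
        ((tendsto_deviationBound hl hM hm hm2).add (tendsto_meanError hκ hd hl hM hm Cκ))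
        (Or.inr ENNReal.ofReal_ne_top)
      rw [add_zero, mul_zero, ENNReal.tendsto_nhds_zero] at hsum
      filter_upwards [hN, hl.eventually_gt_atTop 0, hM.eventually_le_const one_lt_two,
        hsum (ε / 2) (ENNReal.half_pos hε.ne')] with i hNi hli hMi hi
      rw [Nat.cast_one]
      refine (hNi.eLpNorm_one_integral_sub_le hκ hd hli hm (measurableSet_volume_le d K) hm2 hCκ
        hf hC hC0).trans ?_
      have h2 : ENNReal.ofReal (M i * (l i)⁻¹) ≤ 2 :=
        (ENNReal.ofReal_le_ofReal hMi).trans_eq (by simp)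
      calc ENNReal.ofReal C * (2 * (ENNReal.ofReal (M i * (l i)⁻¹) * meanGrain μT Aᶜ 1)
            + deviationBound μT A (l i) (M i) + meanError κ μT Cκ (l i) (M i))
          ≤ ENNReal.ofReal C * (2 * (2 * meanGrain μT Aᶜ 1)
            + deviationBound μT A (l i) (M i) + meanError κ μT Cκ (l i) (M i)) := by gcongr
        _ = ENNReal.ofReal C * 4 * meanGrain μT Aᶜ 1 + ENNReal.ofReal C *
            (deviationBound μT A (l i) (M i) + meanError κ μT Cκ (l i) (M i)) := by ring
        _ ≤ ε / 2 + ε / 2 := add_le_add hK hi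
        _ = ε := ENNReal.add_halves ε
    · have hm2 : meanGrain μT Set.univ 2 ≠ ∞ := meanGrain_ne_top hp.le hT
      have hsum := ENNReal.Tendsto.const_mul (a := ENNReal.ofReal C)
        ((tendsto_deviationBound hl hM hm hm2).add (tendsto_meanError hκ hd hl hM hm Cκ))
        (Or.inr ENNReal.ofReal_ne_top)
      rw [add_zero, mul_zero] at hsum
      refine tendsto_of_tendsto_of_tendsto_of_le_of_le' tendsto_const_nhds hsum
        (Eventually.of_forall fun _ => zero_le) ?_
      filter_upwards [hN, hl.eventually_gt_atTop 0] with i hNi hli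
      exact hNi.eLpNorm_two_integral_sub_le hκ hd hli hm hm2 hCκ hf hC hC0
  -- Membership in `L^q` is a consequence of the limit: the norm of the difference is eventually
  -- finite, and constants lie in `L^q` of a probability space.
  refine ⟨?_, hlim⟩
  filter_upwards [hN, hlim.eventually_lt_const ENNReal.zero_lt_top] with i hNi hi
  have h1 : MemLp (fun ω => (∫ x in grainUnion (l i) (N i ω), f x) - grainLimit κ μT f) q Pr :=
    ⟨(hNi.aestronglyMeasurable_integral (l i) hf).sub aestronglyMeasurable_const, hi⟩
  have h2 := h1.add (memLp_const (grainLimit κ μT f))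
  refine h2.ae_eq (ae_of_all _ fun ω => ?_)
  simp

end Convergence

end GermGrain

theorem theorem6p1 (d : ℕ) (hd : 1 ≤ d)
    (κ : EuclideanSpace ℝ (Fin d) → ℝ) (hκ : GermGrain.IsAdmissibleDensity κ)
    (μT : Measure (Compacts (EuclideanSpace ℝ (Fin d)))) [IsProbabilityMeasure μT]
    (q : ℕ) (hq : q = 1 ∨ q = 2) (p : ℝ) (hp : (q : ℝ) < p)
    (hT : ∫⁻ t : Compacts (EuclideanSpace ℝ (Fin d)),
      volume (t : Set (EuclideanSpace ℝ (Fin d))) ^ p ∂μT < ∞)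
    (f : EuclideanSpace ℝ (Fin d) → ℝ) (hf : Measurable f) (hfb : ∃ C : ℝ, ∀ x, |f x| ≤ C) :
    ∃ c : ℝ,
      (∀ (Ω : Type*) [MeasurableSpace Ω] (Pr : Measure Ω) [IsProbabilityMeasure Pr]
        (P : ℝ → Ω → Set (EuclideanSpace ℝ (Fin d) × Compacts (EuclideanSpace ℝ (Fin d)))),
        (∀ l : ℝ, 0 < l → GermGrain.IsPoissonProcess (P l)
          (ENNReal.ofReal l • (GermGrain.densityMeasure κ).prod μT) Pr) →
        GermGrain.ConvergesInLq
          (fun (l : ℝ) ω => ∫ x in GermGrain.grainUnion l (P l ω), f x) atTop c q Pr) ∧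
      (∀ (Ω : Type*) [MeasurableSpace Ω] (Pr : Measure Ω) [IsProbabilityMeasure Pr]
        (X : ℕ → Ω → Set (EuclideanSpace ℝ (Fin d) × Compacts (EuclideanSpace ℝ (Fin d))))
        (l : ℕ → ℝ),
        (∀ n : ℕ, GermGrain.IsBinomialProcess (X n) n
          ((GermGrain.densityMeasure κ).prod μT) Pr) →
        Tendsto (fun n : ℕ => l n / (n : ℝ)) atTop (𝓝 1) →
        GermGrain.ConvergesInLq
          (fun (n : ℕ) ω => ∫ x in GermGrain.grainUnion (l n) (X n ω), f x) atTop c q Pr) := by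
  have := hκ.isProbabilityMeasure
  refine ⟨GermGrain.grainLimit κ μT f, fun Ω _ Pr _ P hP => ?_, fun Ω _ Pr _ X l hX hl => ?_⟩
  · refine GermGrain.convergesInLq_integral_grainUnion (M := fun l => l) hd hκ hq hp hT hf hfb
      ?_ tendsto_id ?_
    · filter_upwards [eventually_gt_atTop 0] with l hl
      exact (hP l hl).hasPoissonLikeHits hl
    · refine tendsto_const_nhds.congr' ?_
      filter_upwards [eventually_gt_atTop 0] with l hl
      exact (mul_inv_cancel₀ hl.ne').symm
  · have hinv : Tendsto (fun n : ℕ => (n : ℝ) * (l n)⁻¹) atTop (𝓝 1) := by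
      simpa [div_eq_mul_inv] using hl.inv₀ one_ne_zero
    refine GermGrain.convergesInLq_integral_grainUnion (M := fun n : ℕ => (n : ℝ)) hd hκ hq hp hT
      hf hfb (Eventually.of_forall fun n => (hX n).hasPoissonLikeHits) ?_ hinv
    -- `l n = (l n / n) * n` is a product of a factor tending to 1 and one tending to infinity.
    have h := hl.pos_mul_atTop one_pos (tendsto_natCast_atTop_atTop (R := ℝ))
    refine h.congr' ?_
    filter_upwards [eventually_gt_atTop 0] with n hn
    have : (n : ℝ) ≠ 0 := by positivity
    field_simp
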